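/- Let $k$ be a field of characteristic zero and let $I$ be the identity matrix in $\mathrm{SL}(2)(k)$. For $\alpha\in\mathrm{SL}(2)(k)$ let $S_\alpha\subset \mathrm{SL}(2)\times\mathrm{SL}(2)$ be the closed subscheme over $k$ given by the matrix equation $XYX^{-1}Y^{-1}=\alpha$ (the commutator variety). A $k$-scheme of finite type is called $k$-rational of dimension $3$ if it is integral, birationally equivalent over $k$ to an affine space, and of dimension $3$. (i) If $-1$ is a sum of two squares in $k$, then $S_{-I}$ is $k$-rational of dimension $3$. Otherwise $S_{-I}$ has no $k$-points, that is, $S_{-I}(k)=\emptyset$, and $S_{-I}$ is not birationally equivalent over $k$ to any affine space. (ii) If $\alpha\in\mathrm{SL}(2)(k)$ is a non-central element such that $\mathrm{tr}(\alpha)=2$ or $\mathrm{tr}(\alpha)=-2$, then $S_\alpha$ is $k$-rational of dimension $3$. -/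

import Mathlib

open AlgebraicGeometry CategoryTheory MatrixGroups

noncomputable section

namespace CommutatorVariety

universe u

variable (k : Type u) [Field k]

/-- Polynomials in the eight matrix entries of a pair of `2 × 2` matrices; the variable `(0, i, j)`
is the `(i, j)` entry of the first matrix and `(1, i, j)` that of the second one. -/
abbrev EntryPoly : Type u := MvPolynomial (Fin 2 × Fin 2 × Fin 2) k

/-- The generic `2 × 2` matrices. -/
def genericMatrix (l : Fin 2) : Matrix (Fin 2) (Fin 2) (EntryPoly k) :=
  Matrix.of fun i j => MvPolynomial.X (l, i, j)

/-- The ideal of `SL(2) × SL(2)` in the affine space of pairs of matrices. -/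
def detIdeal : Ideal (EntryPoly k) :=
  Ideal.span (Set.range fun l : Fin 2 => (genericMatrix k l).det - 1)

/-- The coordinate ring of `SL(2) × SL(2)` over `k`. -/
abbrev CoordSL2Sq : Type u := EntryPoly k ⧸ detIdeal k

lemma det_map_genericMatrix (l : Fin 2) :
    ((genericMatrix k l).map (Ideal.Quotient.mk (detIdeal k))).det = 1 := by
  have h := (RingHom.map_det (Ideal.Quotient.mk (detIdeal k)) (genericMatrix k l)).symm
  rw [RingHom.mapMatrix_apply] at h
  rw [h, ← map_one (Ideal.Quotient.mk (detIdeal k)), Ideal.Quotient.eq]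
  exact Ideal.subset_span ⟨l, rfl⟩

/-- The universal elements `X` (for `l = 0`) and `Y` (for `l = 1`) of `SL(2)` over the coordinate
ring of `SL(2) × SL(2)`. -/
def universalElement (l : Fin 2) : SL(2, CoordSL2Sq k) :=
  ⟨(genericMatrix k l).map (Ideal.Quotient.mk (detIdeal k)), det_map_genericMatrix k l⟩

variable {k}

/-- The ideal of the closed subscheme of `SL(2) × SL(2)` given by the matrix equation
`X Y X⁻¹ Y⁻¹ = α`. -/
def commutatorIdeal (α : SL(2, k)) : Ideal (CoordSL2Sq k) :=
  Ideal.span (Set.range fun p : Fin 2 × Fin 2 =>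
    (universalElement k 0 * universalElement k 1 *
        (universalElement k 0)⁻¹ * (universalElement k 1)⁻¹) p.1 p.2 -
      algebraMap k (CoordSL2Sq k) (α p.1 p.2))

/-- The coordinate ring of the commutator variety. -/
abbrev CoordRing (α : SL(2, k)) : Type u := CoordSL2Sq k ⧸ commutatorIdeal α

/-- The commutator variety `S_α`, as a scheme. -/
def S (α : SL(2, k)) : Scheme.{u} := Spec (CommRingCat.of (CoordRing α))

/-- The structure morphism `S_α ⟶ Spec k`. -/
def structureMap (α : SL(2, k)) : S α ⟶ Spec (CommRingCat.of k) :=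
  Spec.map (CommRingCat.ofHom (algebraMap k (CoordRing α)))

/-- A `k`-scheme is a `k`-rational variety of dimension `d` if it is integral, birational over `k`
to an affine space, and has Krull dimension `d`. -/
structure IsRationalOfDim {X : Scheme.{u}} (s : X ⟶ Spec (CommRingCat.of k)) (d : ℕ) : Prop where
  isIntegral : IsIntegral X
  isRationalOver : Scheme.IsRationalOver s
  dim_eq : topologicalKrullDim X = d

/-- The set `X(k)` of `k`-points of a `k`-scheme: sections of the structure morphism. -/
abbrev RatPoint {X : Scheme.{u}} (s : X ⟶ Spec (CommRingCat.of k)) : Type u :=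
  {p : Spec (CommRingCat.of k) ⟶ X // p ≫ s = 𝟙 (Spec (CommRingCat.of k))}

end CommutatorVariety

end

/-! The rationality statements share one mechanism. In the coordinate ring `A` of `S_α`, an element
`f` is found such that `A_f` is isomorphic to a localization `k[x, y, z]_g`. Substitutions in `(X,
Y)` that preserve the commutator give automorphisms of `A`. The translates of `f` under them
generate the unit ideal, and none of them vanishes identically on the chart, so the translated
charts cover `S_α` and each meets the first one. Hence `A` is a domain
(`HasAffineChart.of_translates`). The chart then gives birationality with affine 3-space, and its
transcendence degree gives the dimension (`HasAffineChart.ringKrullDim_eq`).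

For noncentral `α` of trace `±2`, conjugation reduces to a Jordan block. With eigenvalue `1`, both
matrices are upper triangular and one equation remains, linear in the upper right entries
(`hasAffineChart_unipotent`). With eigenvalue `-1`, the traces `t, s, w` of `X, Y, XY` satisfy the
Markov-type equation `t² + s² + w² = t s w`. This cubic is singular at the origin, so the ratios
`s/t` and `w/t` parametrize it, and one entry of `X` completes the coordinates
(`hasAffineChart_jordan_neg_one`).

For `α = -I`, the matrices `X`, `Y` and `XY` have trace zero and anticommute pairwise. Their lower
left entries `c, g, m` satisfy `c² + g² + m² = 0`. This conic has a `k`-point exactly when `-1` is a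
sum of two squares. If so, projection from the point yields a chart (`hasAffineChart_neg_one`). If
not, `S_{-I}` has no `k`-point (`exists_sum_sq_of_ratPoint`), so it is not rational: over an
infinite field a rational scheme has a `k`-point (`exists_section_of_isRationalOver`). -/

namespace CommutatorVariety

universe u

/-! ### Integrality of a ring from a cover by principal opens -/

section Domain

variable {A : Type*} [CommRing A]

/-- The localization of `A` away from `f` has no zero divisors. -/
def NoZeroDivisorsAway (f : A) : Prop :=
  ∀ x y : A, x * y = 0 → (∃ n : ℕ, f ^ n * x = 0) ∨ ∃ n : ℕ, f ^ n * y = 0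

/-- A one-sided inverse is enough: a relation `f ^ n * τ x = 0` is carried by `σ` to `σ f ^ n * x =
0`. -/
lemma NoZeroDivisorsAway.of_map {f : A} (h : NoZeroDivisorsAway f) (σ τ : A →+* A)
    (hστ : ∀ x, σ (τ x) = x) : NoZeroDivisorsAway (σ f) := by
  have key : ∀ x n, f ^ n * τ x = 0 → σ f ^ n * x = 0 := fun x n hx => by
    simpa [hστ] using congrArg σ hx
  intro x y hxy
  rcases h (τ x) (τ y) (by rw [← map_mul, hxy, map_zero]) with ⟨n, hn⟩ | ⟨n, hn⟩
  exacts [.inl ⟨n, key _ _ hn⟩, .inr ⟨n, key _ _ hn⟩]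

lemma NoZeroDivisorsAway.of_localization {f : A} (h : IsDomain (Localization.Away f)) :
    NoZeroDivisorsAway f := by
  have key : ∀ x : A, algebraMap A (Localization.Away f) x = 0 → ∃ n : ℕ, f ^ n * x = 0 := by
    intro x hx
    obtain ⟨⟨_, n, rfl⟩, hm⟩ :=
      (IsLocalization.map_eq_zero_iff (Submonoid.powers f) (Localization.Away f) x).1 hx
    exact ⟨n, hm⟩
  intro x y hxy
  have hz : algebraMap A (Localization.Away f) x * algebraMap A (Localization.Away f) y = 0 := by
    rw [← map_mul, hxy, map_zero]
  exact (mul_eq_zero.1 hz).imp (key x) (key y)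

/-- A ring covered by principal opens that are integral and meet a fixed one of them is a
domain. -/
lemma isDomain_of_cover {ι : Type*} (f : ι → A) (hf : Ideal.span (Set.range f) = ⊤)
    (hd : ∀ i, NoZeroDivisorsAway (f i)) (i₀ : ι) {D : Type*} [CommRing D] [IsDomain D]
    (φ : A →+* D) (hφ : ∀ i, φ (f i) ≠ 0) : IsDomain A := by
  have key : ∀ x, (∃ n : ℕ, f i₀ ^ n * x = 0) → x = 0 := by
    rintro x ⟨n, hn⟩
    have hx : ∀ i, ∃ m : ℕ, f i ^ m * x = 0 := by
      intro i
      -- On the open set of `f i`, either `x` or a power of `f i₀` dies. The latter is excluded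
      -- because `φ` sends both `f i` and `f i₀` to nonzero elements of a domain: the two opens
      -- meet.
      refine (hd i _ _ hn).resolve_left ?_
      rintro ⟨m, hm⟩
      have := congrArg φ hm
      rw [map_mul, map_pow, map_pow, map_zero] at this
      exact mul_ne_zero (pow_ne_zero _ (hφ i)) (pow_ne_zero _ (hφ i₀)) this
    refine (Submodule.mem_bot A).1
      (Submodule.mem_of_span_eq_top_of_smul_pow_mem ⊥ (Set.range f) hf x ?_)
    rintro ⟨_, i, rfl⟩
    simpa using hx i
  have : Nontrivial A := φ.domain_nontrivial
  have : NoZeroDivisors A := ⟨fun {x y} hxy => (hd i₀ x y hxy).imp (key x) (key y)⟩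
  exact NoZeroDivisors.to_isDomain A

end Domain

/-! ### Isomorphisms between principal opens -/

section Chart

variable {k : Type*} [Field k] {A : Type*} [CommRing A] [Algebra k A] {σ : Type*}

/-- The maps `φ` and `ψ` extend to the localizations and become mutually inverse. Conditions `h₁`
and `h₂` need checking only on generators; `χ` stands for the extension of the other map and is used
only through its values there. -/
lemma nonempty_chart (f : A) (g : MvPolynomial σ k)
    (φ : A →ₐ[k] Localization.Away g) (ψ : MvPolynomial σ k →ₐ[k] Localization.Away f)
    (hφ : IsUnit (φ f)) (hψ : IsUnit (ψ g))
    (h₁ : ∀ χ : Localization.Away g →ₐ[k] Localization.Away f,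
      (∀ i, χ (algebraMap (MvPolynomial σ k) _ (MvPolynomial.X i)) = ψ (MvPolynomial.X i)) →
      χ.comp φ = IsScalarTower.toAlgHom k A (Localization.Away f))
    (h₂ : ∀ χ : Localization.Away f →ₐ[k] Localization.Away g,
      (∀ a, χ (algebraMap A _ a) = φ a) →
      ∀ i, χ (ψ (MvPolynomial.X i)) = algebraMap (MvPolynomial σ k) _ (MvPolynomial.X i)) :
    Nonempty (Localization.Away f ≃ₐ[k] Localization.Away g) := by
  have hφ' : ∀ y : Submonoid.powers f, IsUnit (φ y) := by
    rintro ⟨_, n, rfl⟩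
    simpa using hφ.pow n
  have hψ' : ∀ y : Submonoid.powers g, IsUnit (ψ y) := by
    rintro ⟨_, n, rfl⟩
    simpa using hψ.pow n
  let Φ : Localization.Away f →ₐ[k] Localization.Away g := IsLocalization.liftAlgHom hφ'
  let Ψ : Localization.Away g →ₐ[k] Localization.Away f := IsLocalization.liftAlgHom hψ'
  have hΦ : ∀ a, Φ (algebraMap A _ a) = φ a := fun a => IsLocalization.lift_eq _ _
  have hΨ : ∀ a, Ψ (algebraMap (MvPolynomial σ k) _ a) = ψ a := fun a => IsLocalization.lift_eq _ _
  refine ⟨AlgEquiv.ofAlgHom Φ Ψ ?_ ?_⟩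
  · refine IsLocalization.algHom_ext (Submonoid.powers g) ?_
    refine MvPolynomial.algHom_ext fun i => ?_
    change Φ (Ψ (algebraMap (MvPolynomial σ k) _ _)) = _
    rw [hΨ]
    exact h₂ Φ hΦ i
  · refine IsLocalization.algHom_ext (Submonoid.powers f) ?_
    refine AlgHom.ext fun a => ?_
    change Ψ (Φ (algebraMap A _ _)) = _
    rw [hΦ]
    exact DFunLike.congr_fun (h₁ Ψ fun i => hΨ _) a

end Chart

/-! ### Dimension and transcendence degree -/

section Dimension

/-- Incomparability makes contraction of primes strictly monotone, which gives `≤`. Lying over for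
the smallest prime of a chain, followed by going up, lifts the chain and gives `≥`. -/
lemma ringKrullDim_eq_of_isIntegral (R S : Type*) [CommRing R] [CommRing S] [Algebra R S]
    [Algebra.IsIntegral R S] [FaithfulSMul R S] : ringKrullDim S = ringKrullDim R := by
  apply le_antisymm
  · refine Order.krullDim_le_of_strictMono (PrimeSpectrum.comap (algebraMap R S)) fun p q h => ?_
    exact Ideal.IsIntegral.comap_lt_comap (R := R) (I := p.asIdeal) (J := q.asIdeal) h
  · refine iSup_le fun l => ?_
    obtain ⟨Q, hQ, hQl⟩ := Ideal.exists_ideal_over_prime_of_isIntegral (S := S)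
      l.head.asIdeal ⊥ (by
        rw [← RingHom.ker_eq_comap_bot, (RingHom.injective_iff_ker_eq_bot _).1
          (FaithfulSMul.algebraMap_injective R S)]
        exact bot_le)
    obtain ⟨hQp, hQ'⟩ := hQl
    have : Q.LiesOver l.head.asIdeal := ⟨hQ'.symm⟩
    obtain ⟨m, hm, -⟩ := Ideal.exists_ltSeries_of_hasGoingUp l Q
    rw [← hm]
    exact le_iSup (fun l : LTSeries (PrimeSpectrum S) => (l.length : WithBot ℕ∞)) m

open Cardinal in
/-- The dimension of a finitely generated domain over a field is its transcendence degree. -/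
lemma ringKrullDim_eq_of_trdeg_eq (k A : Type*) [Field k] [CommRing A] [IsDomain A] [Algebra k A]
    [Algebra.FiniteType k A] {d : ℕ} (hd : Algebra.trdeg k A = d) : ringKrullDim A = d := by
  -- Noether normalization: `A` is integral over a polynomial ring in `s` variables, and comparing
  -- transcendence degrees gives `s = d`.
  obtain ⟨s, g, hg, hi⟩ := exists_integral_inj_algHom_of_fg k A
  algebraize [g.toRingHom]
  have : Algebra.IsIntegral (MvPolynomial (Fin s) k) A := ⟨hi⟩
  have : FaithfulSMul (MvPolynomial (Fin s) k) A := (faithfulSMul_iff_algebraMap_injective _ _).2 hg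
  have : IsScalarTower k (MvPolynomial (Fin s) k) A :=
    IsScalarTower.of_algebraMap_eq fun r => (g.commutes r).symm
  have h := lift_trdeg_add_eq k (MvPolynomial (Fin s) k) A
  rw [hd, trdeg_eq_zero (R := MvPolynomial (Fin s) k) (A := A)] at h
  simp at h
  rw [ringKrullDim_eq_of_isIntegral (MvPolynomial (Fin s) k) A]
  simp [← h]

end Dimension

/-- A `k`-algebra domain with a principal open isomorphic to a principal open of affine space. -/
structure HasAffineChart (k : Type*) [Field k] (A : Type*) [CommRing A] [Algebra k A] (n : ℕ) :
    Prop where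
  isDomain : IsDomain A
  exists_chart : ∃ (f : A) (g : MvPolynomial (Fin n) k), f ≠ 0 ∧ g ≠ 0 ∧
    Nonempty (Localization.Away f ≃ₐ[k] Localization.Away g)

lemma trdeg_localizationAway {k A : Type*} [Field k] [CommRing A] [IsDomain A] [Algebra k A]
    {f : A} (hf : f ≠ 0) : Algebra.trdeg k (Localization.Away f) = Algebra.trdeg k A := by
  have hle := powers_le_nonZeroDivisors_of_noZeroDivisors hf
  have : IsDomain (Localization.Away f) := IsLocalization.isDomain_localization hle
  have : FaithfulSMul A (Localization.Away f) :=
    (faithfulSMul_iff_algebraMap_injective _ _).2 (IsLocalization.injective _ hle)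
  have : Algebra.IsAlgebraic A (Localization.Away f) :=
    IsLocalization.isAlgebraic  _ (Submonoid.powers f)
  have h := trdeg_add_eq k A (A := Localization.Away f)
  rw [trdeg_eq_zero (R := A)] at h
  simpa using h.symm

lemma HasAffineChart.ringKrullDim_eq {k A : Type*} [Field k] [CommRing A] [Algebra k A]
    [Algebra.FiniteType k A] {n : ℕ} (h : HasAffineChart k A n) : ringKrullDim A = n := by
  have := h.isDomain
  obtain ⟨f, g, hf, hg, ⟨e⟩⟩ := h.exists_chart
  apply ringKrullDim_eq_of_trdeg_eq k
  have := e.lift_trdeg_eq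
  rw [trdeg_localizationAway hf, trdeg_localizationAway hg] at this
  simpa using this

lemma HasAffineChart.of_algEquiv {k A B : Type*} [Field k] [CommRing A] [Algebra k A]
    [CommRing B] [Algebra k B] {n : ℕ} (h : HasAffineChart k A n) (e : A ≃ₐ[k] B) :
    HasAffineChart k B n := by
  have := h.isDomain
  obtain ⟨f, g, hf, hg, ⟨c⟩⟩ := h.exists_chart
  refine ⟨e.symm.toMulEquiv.isDomain _, e f, g, by simpa using hf, hg, ⟨?_⟩⟩
  refine AlgEquiv.trans (AlgEquiv.symm ?_) c
  exact IsLocalization.algEquivOfAlgEquiv (Localization.Away f) (Localization.Away (e f))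
    (M := Submonoid.powers f) (T := Submonoid.powers (e f)) e (by simp)

/-! ### From charts to birational maps and rational points -/

section Geometry

variable {k : Type u} [Field k]

lemma dominant_spec_away (A : Type u) [CommRing A] [IsDomain A] {f : A} (hf : f ≠ 0) :
    IsDominant (Spec.map (CommRingCat.ofHom (algebraMap A (Localization.Away f)))) := by
  have hle := powers_le_nonZeroDivisors_of_noZeroDivisors hf
  refine ⟨?_⟩
  have := (PrimeSpectrum.denseRange_comap_iff_ker_le_nilRadical
    (algebraMap A (Localization.Away f))).2 (by
    rw [(RingHom.injective_iff_ker_eq_bot _).1 (IsLocalization.injective _ hle)]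
    exact bot_le)
  exact this

lemma birationalOver_away (A : Type u) [CommRing A] [IsDomain A] [Algebra k A] {f : A}
    (hf : f ≠ 0) : Scheme.BirationalOver
      (Spec.map (CommRingCat.ofHom (algebraMap k (Localization.Away f))))
      (Spec.map (CommRingCat.ofHom (algebraMap k A))) := by
  have := dominant_spec_away A hf
  refine Scheme.Hom.birationalOver
    (Spec.map (CommRingCat.ofHom (algebraMap A (Localization.Away f)))) _ _ ?_
  rw [← Spec.map_comp, ← CommRingCat.ofHom_comp, ← IsScalarTower.algebraMap_eq]

lemma birationalOver_of_algEquiv {A B : Type u} [CommRing A] [Algebra k A] [CommRing B]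
    [Algebra k B] (e : A ≃ₐ[k] B) : Scheme.BirationalOver
      (Spec.map (CommRingCat.ofHom (algebraMap k A)))
      (Spec.map (CommRingCat.ofHom (algebraMap k B))) := by
  have : IsIso (CommRingCat.ofHom (e.symm : B →+* A)) :=
    inferInstanceAs (IsIso e.symm.toRingEquiv.toCommRingCatIso.hom)
  refine Scheme.Hom.birationalOver (Spec.map (CommRingCat.ofHom (e.symm : B →+* A))) _ _ ?_
  rw [← Spec.map_comp, ← CommRingCat.ofHom_comp]
  congr 2
  ext x
  simp

lemma HasAffineChart.isRationalOver {A : Type u} [CommRing A] [Algebra k A] {n : ℕ}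
    (h : HasAffineChart k A n) :
    Scheme.IsRationalOver (Spec.map (CommRingCat.ofHom (algebraMap k A))) := by
  have := h.isDomain
  obtain ⟨f, g, hf, hg, ⟨e⟩⟩ := h.exists_chart
  refine ⟨ULift (Fin n), (birationalOver_away A hf).symm.trans ((birationalOver_of_algEquiv e).trans
    ((birationalOver_away _ hg).trans ((birationalOver_of_algEquiv
      (MvPolynomial.renameEquiv k (Equiv.ulift.{u} (α := Fin n)).symm)).trans ?_)))⟩
  exact Scheme.Hom.birationalOver (AffineSpace.SpecIso (ULift (Fin n)) (.of k)).inv _ _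
    (AffineSpace.SpecIso_inv_over _)

lemma HasAffineChart.isRationalOfDim {α : SL(2, k)} {n : ℕ} (h : HasAffineChart k (CoordRing α) n) :
    IsRationalOfDim (structureMap α) n where
  isIntegral := by
    have := h.isDomain
    exact inferInstanceAs (IsIntegral (Spec (CommRingCat.of (CoordRing α))))
  isRationalOver := h.isRationalOver
  dim_eq := by
    rw [← h.ringKrullDim_eq]
    exact PrimeSpectrum.topologicalKrullDim_eq_ringKrullDim (CoordRing α)

/-- A rational scheme over an infinite field has a rational point. -/
lemma exists_section_of_isRationalOver [Infinite k] {X : Scheme.{u}}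
    (s : X ⟶ Spec (CommRingCat.of k)) (h : Scheme.IsRationalOver s) : Nonempty (RatPoint s) := by
  obtain ⟨n, e, he⟩ := h.exists_birationalOver_affineSpace
  let i := AffineSpace.SpecIso n (CommRingCat.of k)
  obtain ⟨x, hx⟩ := e.dense_target.nonempty
  have hx' : i.hom x ∈ i.inv ⁻¹ᵁ e.target := by
    change i.inv (i.hom x) ∈ e.target
    simpa using hx
  obtain ⟨_, ⟨_, ⟨g, rfl⟩, rfl⟩, hxg, hgU⟩ :=
    PrimeSpectrum.isBasis_basic_opens.exists_subset_of_mem_open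
      (SetLike.mem_coe.2 hx') (i.inv ⁻¹ᵁ e.target).isOpen
  have hg : g ≠ 0 := by
    rintro rfl
    exact hxg (Ideal.zero_mem _)
  -- The open set of affine space where the birational map is defined contains a basic open `D(g)`
  -- with `g ≠ 0`. Over an infinite field `g` is nonzero at some `k`-point, which is then
  -- transported to `X`.
  obtain ⟨v, hv⟩ : ∃ v : n → k, MvPolynomial.eval v g ≠ 0 := by
    by_contra! hv
    exact hg (MvPolynomial.funext fun v => by simpa using hv v)
  let q := Spec.map (CommRingCat.ofHom (MvPolynomial.eval v)) ≫ i.inv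
  have hq : q ≫ (𝔸(n; Spec (CommRingCat.of k)) ↘ Spec (CommRingCat.of k)) = 𝟙 _ := by
    rw [Category.assoc, AffineSpace.SpecIso_inv_over, ← Spec.map_comp, ← Spec.map_id]
    congr 1
    ext x
    simp
  have hr : Set.range q ⊆ Set.range e.target.ι := by
    rintro _ ⟨y, rfl⟩
    rw [Scheme.Opens.range_ι]
    refine hgU (a := Spec.map (CommRingCat.ofHom (MvPolynomial.eval v)) y) ?_
    intro hmem
    have hy : MvPolynomial.eval v g ∈ PrimeSpectrum.asIdeal y := hmem
    exact y.2.ne_top (Ideal.eq_top_of_isUnit_mem _ hy (IsUnit.mk0 _ hv))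
  refine ⟨⟨IsOpenImmersion.lift e.target.ι q hr ≫ e.iso.inv ≫ e.source.ι, ?_⟩⟩
  have he' : e.iso.inv ≫ e.source.ι ≫ s = e.target.ι ≫ (𝔸(n; Spec (CommRingCat.of k)) ↘ _) := by
    rw [Iso.inv_comp_eq]
    exact Eq.symm he
  rw [Category.assoc, Category.assoc, he', IsOpenImmersion.lift_fac_assoc, hq]

end Geometry

/-! ### The functor of points of the commutator variety -/

section UniversalProperty

open Matrix

variable {k : Type u} [Field k]

/-- The coordinate ring of the commutator variety, with its algebra structure sealed. -/
def Coord (α : SL(2, k)) : Type u := CoordRing α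

noncomputable instance (α : SL(2, k)) : CommRing (Coord α) :=
  inferInstanceAs (CommRing (CoordRing α))

noncomputable instance (α : SL(2, k)) : Algebra k (Coord α) :=
  inferInstanceAs (Algebra k (CoordRing α))

/-- The tautological isomorphism between the two forms of the coordinate ring. -/
noncomputable def coordEquiv (α : SL(2, k)) : Coord α ≃ₐ[k] CoordRing α where
  __ := RingEquiv.refl (CoordRing α)
  commutes' _ := rfl

/-- The quotient map onto the coordinate ring. -/
noncomputable def toCoord (α : SL(2, k)) : CoordSL2Sq k →ₐ[k] Coord α where
  __ := Ideal.Quotient.mk (commutatorIdeal α)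
  commutes' _ := rfl

lemma toCoord_surjective (α : SL(2, k)) : Function.Surjective (toCoord α) :=
  Ideal.Quotient.mk_surjective

/-- The universal pair over the coordinate ring of the commutator variety. -/
noncomputable def pair (α : SL(2, k)) (l : Fin 2) : SL(2, Coord α) :=
  SpecialLinearGroup.map (toCoord α : CoordSL2Sq k →+* Coord α) (universalElement k l)

lemma pair_comm (α : SL(2, k)) :
    pair α 0 * pair α 1 * (pair α 0)⁻¹ * (pair α 1)⁻¹ =
      SpecialLinearGroup.map (algebraMap k (Coord α)) α := by
  simp only [pair, ← map_mul, ← map_inv]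
  ext i j
  have h : (universalElement k 0 * universalElement k 1 *
        (universalElement k 0)⁻¹ * (universalElement k 1)⁻¹) i j -
      algebraMap k (CoordSL2Sq k) (α i j) ∈ commutatorIdeal α :=
    Ideal.subset_span ⟨(i, j), rfl⟩
  exact Ideal.Quotient.eq.2 h

variable {α : SL(2, k)} {R : Type*} [CommRing R] [Algebra k R]

lemma algHom_ext {φ ψ : Coord α →ₐ[k] R}
    (h : ∀ l i j, φ ((pair α l).1 i j) = ψ ((pair α l).1 i j)) : φ = ψ := by
  have h' : φ.comp (toCoord α) = ψ.comp (toCoord α) := by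
    refine Ideal.Quotient.algHom_ext _ (MvPolynomial.algHom_ext ?_)
    rintro ⟨l, i, j⟩
    exact h l i j
  refine AlgHom.ext fun x => ?_
  obtain ⟨y, rfl⟩ := toCoord_surjective α x
  exact DFunLike.congr_fun h' y

lemma detIdeal_le_ker (X : Fin 2 → SL(2, R)) : detIdeal k ≤
    RingHom.ker (MvPolynomial.aeval fun p => X p.1 p.2.1 p.2.2 : EntryPoly k →ₐ[k] R) := by
  refine Ideal.span_le.2 ?_
  rintro _ ⟨l, rfl⟩
  have := (X l).2
  rw [det_fin_two] at this
  simp [genericMatrix, det_fin_two, RingHom.mem_ker, this]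

/-- The morphism from the coordinate ring of `SL(2) × SL(2)` given by a pair of matrices. -/
noncomputable def liftSL (X : Fin 2 → SL(2, R)) : CoordSL2Sq k →ₐ[k] R :=
  Ideal.Quotient.liftₐ (detIdeal k) (MvPolynomial.aeval fun p => X p.1 p.2.1 p.2.2)
    fun _ ha => detIdeal_le_ker X ha

lemma map_liftSL (X : Fin 2 → SL(2, R)) (l : Fin 2) :
    SpecialLinearGroup.map (liftSL (k := k) X : CoordSL2Sq k →+* R) (universalElement k l) =
      X l := by
  ext i j
  change MvPolynomial.aeval (fun p => X p.1 p.2.1 p.2.2) (MvPolynomial.X (l, i, j)) = _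
  simp

lemma commutatorIdeal_le_ker (X : Fin 2 → SL(2, R))
    (h : X 0 * X 1 * (X 0)⁻¹ * (X 1)⁻¹ = SpecialLinearGroup.map (algebraMap k R) α) :
    commutatorIdeal α ≤ RingHom.ker (liftSL X : CoordSL2Sq k →ₐ[k] R) := by
  refine Ideal.span_le.2 ?_
  rintro _ ⟨⟨i, j⟩, rfl⟩
  have h' : SpecialLinearGroup.map (liftSL (k := k) X : CoordSL2Sq k →+* R)
      (universalElement k 0 * universalElement k 1 *
      (universalElement k 0)⁻¹ * (universalElement k 1)⁻¹) =
      SpecialLinearGroup.map (algebraMap k R) α := by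
    simp only [map_mul, map_inv, map_liftSL, h]
  have := congrArg (fun M : SL(2, R) => M i j) h'
  change liftSL X _ = algebraMap k R _ at this
  change liftSL X _ = 0
  rw [map_sub, this, AlgHom.commutes, sub_self]

/-- The morphism from the coordinate ring of the commutator variety given by a pair of matrices
with the prescribed commutator. -/
noncomputable def lift (X : Fin 2 → SL(2, R))
    (h : X 0 * X 1 * (X 0)⁻¹ * (X 1)⁻¹ = SpecialLinearGroup.map (algebraMap k R) α) :
    Coord α →ₐ[k] R :=
  (Ideal.Quotient.liftₐ (commutatorIdeal α) (liftSL X)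
    fun _ ha => commutatorIdeal_le_ker X h ha).comp (coordEquiv α).toAlgHom

lemma liftSL_universalElement (X : Fin 2 → SL(2, R)) (l i j : Fin 2) :
    liftSL (k := k) X ((universalElement k l).1 i j) = (X l).1 i j :=
  congrArg (fun M : SL(2, R) => M.1 i j) (map_liftSL X l)

lemma lift_pair (X : Fin 2 → SL(2, R)) (h) (l i j : Fin 2) :
    lift (α := α) X h ((pair α l).1 i j) = (X l).1 i j := by
  rw [← liftSL_universalElement (k := k) X l i j]
  exact Ideal.Quotient.lift_mk (commutatorIdeal α) _ fun _ ha => commutatorIdeal_le_ker X h ha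

lemma map_lift (X : Fin 2 → SL(2, R)) (h) (l : Fin 2) :
    SpecialLinearGroup.map (lift (α := α) X h : Coord α →+* R) (pair α l) = X l := by
  ext i j
  exact lift_pair X h l i j

lemma map_pair_comm (φ : Coord α →ₐ[k] R) :
    SpecialLinearGroup.map (φ : Coord α →+* R) (pair α 0) *
      SpecialLinearGroup.map (φ : Coord α →+* R) (pair α 1) *
      (SpecialLinearGroup.map (φ : Coord α →+* R) (pair α 0))⁻¹ *
      (SpecialLinearGroup.map (φ : Coord α →+* R) (pair α 1))⁻¹ =
      SpecialLinearGroup.map (algebraMap k R) α := by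
  simp only [← map_mul, ← map_inv, pair_comm]
  ext i j
  simp

lemma algHom_ext' {φ ψ : Coord α →ₐ[k] R}
    (h : ∀ l, SpecialLinearGroup.map (φ : Coord α →+* R) (pair α l) =
      SpecialLinearGroup.map (ψ : Coord α →+* R) (pair α l)) : φ = ψ :=
  algHom_ext fun l i j => congrArg (fun M : SL(2, R) => M i j) (h l)

/-- Equality of commutators in terms of entries. -/
lemma commutator_eq_iff {R : Type*} [CommRing R] (X Y B : SL(2, R)) :
    X * Y * X⁻¹ * Y⁻¹ = B ↔ X.1 * Y.1 = B.1 * (Y.1 * X.1) := by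
  rw [mul_inv_eq_iff_eq_mul, mul_inv_eq_iff_eq_mul, mul_assoc B Y X]
  exact Subtype.ext_iff

end UniversalProperty

open Matrix

/-! ### Rationality from a chart and its translates -/

section Cover

variable {k : Type*} [Field k] {A : Type*} [CommRing A] [Algebra k A] {n : ℕ}

lemma isDomain_localizationAway {D : Type*} [CommRing D] [IsDomain D] {g : D} (hg : g ≠ 0) :
    IsDomain (Localization.Away g) :=
  IsLocalization.isDomain_localization (powers_le_nonZeroDivisors_of_noZeroDivisors hg)

/-- An algebra covered by translates of a chart under automorphisms is a rational domain. -/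
lemma HasAffineChart.of_translates {f : A} {g : MvPolynomial (Fin n) k} (hg : g ≠ 0)
    (e : Nonempty (Localization.Away f ≃ₐ[k] Localization.Away g))
    (φ : A →ₐ[k] Localization.Away g) {s : Set A} (hfs : f ∈ s) (hs : Ideal.span s = ⊤)
    (ht : ∀ a ∈ s, ∃ σ τ : A →ₐ[k] A, σ.comp τ = AlgHom.id k A ∧ σ f = a)
    (hφ : ∀ a ∈ s, φ a ≠ 0) : HasAffineChart k A n := by
  have := isDomain_localizationAway hg
  obtain ⟨e⟩ := e
  have hf : NoZeroDivisorsAway f := .of_localization e.toMulEquiv.isDomain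
  refine ⟨isDomain_of_cover (fun a : s => (a : A)) (by simpa using hs) ?_ ⟨f, hfs⟩
    (φ : A →+* Localization.Away g) fun a => hφ a a.2, f, g, ?_, hg, ⟨e⟩⟩
  · rintro ⟨a, ha⟩
    obtain ⟨σ, τ, hστ, rfl⟩ := ht a ha
    exact hf.of_map (σ : A →+* A) (τ : A →+* A) fun x => DFunLike.congr_fun hστ x
  · rintro rfl
    exact hφ 0 hfs (map_zero φ)

end Cover

/-! ### Conjugation and commutator-preserving substitutions -/

section Symmetries

variable {k : Type u} [Field k]

/-- Conjugation of the special linear group by an element of the general linear group. -/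
noncomputable def conjSL {R : Type*} [CommRing R] (P : GL (Fin 2) R) : SL(2, R) →* SL(2, R) where
  toFun X := ⟨P.1 * X.1 * P⁻¹.1, by
    rw [det_mul, det_mul, X.2, mul_one, ← det_mul, Units.mul_inv, det_one]⟩
  map_one' := by apply Subtype.ext; simp
  map_mul' X Y := by
    apply Subtype.ext
    change P.1 * (X.1 * Y.1) * P⁻¹.1 = P.1 * X.1 * P⁻¹.1 * (P.1 * Y.1 * P⁻¹.1)
    simp [mul_assoc]

lemma conjSL_conjSL {R : Type*} [CommRing R] (P Q : GL (Fin 2) R) (X : SL(2, R)) :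
    conjSL P (conjSL Q X) = conjSL (P * Q) X := by
  apply Subtype.ext
  change P.1 * (Q.1 * X.1 * Q⁻¹.1) * P⁻¹.1 = (P * Q).1 * X.1 * (P * Q)⁻¹.1
  simp [mul_assoc]

lemma conjSL_one {R : Type*} [CommRing R] (X : SL(2, R)) : conjSL 1 X = X := by
  apply Subtype.ext
  change (1 : GL (Fin 2) R).1 * X.1 * (1 : GL (Fin 2) R)⁻¹.1 = X.1
  simp

lemma map_conjSL {R S : Type*} [CommRing R] [CommRing S] (f : R →+* S) (P : GL (Fin 2) R)
    (X : SL(2, R)) : SpecialLinearGroup.map f (conjSL P X) =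
      conjSL (GeneralLinearGroup.map f P) (SpecialLinearGroup.map f X) := by
  apply Subtype.ext
  change (P.1 * X.1 * P⁻¹.1).map f = P.1.map f * X.1.map f * (GeneralLinearGroup.map f P)⁻¹.1
  rw [← map_inv, Matrix.map_mul, Matrix.map_mul]
  rfl

/-- Conjugation maps `S_α` to the commutator variety of the conjugate of `α`. -/
noncomputable def conjHom {α β : SL(2, k)} (P : GL (Fin 2) k) (h : conjSL P α = β) :
    Coord β →ₐ[k] Coord α :=
  lift (fun l => conjSL (GeneralLinearGroup.map (algebraMap k _) P) (pair α l)) (by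
    simp only [← map_mul, ← map_inv, pair_comm, ← h, map_conjSL])

lemma map_conjHom {α β : SL(2, k)} (P : GL (Fin 2) k) (h : conjSL P α = β) (l : Fin 2) :
    SpecialLinearGroup.map (conjHom P h : Coord β →+* Coord α) (pair β l) =
      conjSL (GeneralLinearGroup.map (algebraMap k _) P) (pair α l) := map_lift _ _ l

lemma map_comp_pair {α : SL(2, k)} {R S : Type*} [CommRing R] [Algebra k R] [CommRing S]
    [Algebra k S] (φ : R →ₐ[k] S) (ψ : Coord α →ₐ[k] R) (x : SL(2, Coord α)) :
    SpecialLinearGroup.map (φ.comp ψ : Coord α →+* S) x =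
      SpecialLinearGroup.map (φ : R →+* S)
        (SpecialLinearGroup.map (ψ : Coord α →+* R) x) := rfl

lemma map_id_pair {α : SL(2, k)} (x : SL(2, Coord α)) :
    SpecialLinearGroup.map (AlgHom.id k (Coord α) : Coord α →+* Coord α) x = x := rfl

lemma conjHom_comp {α β : SL(2, k)} (P Q : GL (Fin 2) k) (h : conjSL P α = β)
    (h' : conjSL Q β = α) (hPQ : Q * P = 1) :
    (conjHom P h).comp (conjHom Q h') = AlgHom.id k _ := by
  refine algHom_ext' fun l => ?_
  have hm : GeneralLinearGroup.map (conjHom P h : Coord β →+* Coord α)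
      (GeneralLinearGroup.map (algebraMap k _) Q) =
      GeneralLinearGroup.map (algebraMap k (Coord α)) Q := by
    ext i j
    simp
  rw [map_comp_pair, map_id_pair, map_conjHom, map_conjSL, hm, map_conjHom,
    conjSL_conjSL, ← map_mul, hPQ, map_one, conjSL_one]

/-- Conjugate elements have isomorphic commutator varieties. -/
noncomputable def conjEquiv {α β : SL(2, k)} (P : GL (Fin 2) k) (h : conjSL P α = β) :
    Coord β ≃ₐ[k] Coord α :=
  AlgEquiv.ofAlgHom (conjHom P h)
    (conjHom P⁻¹ (by rw [← h, conjSL_conjSL, inv_mul_cancel, conjSL_one]))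
    (conjHom_comp _ _ _ _ (inv_mul_cancel P)) (conjHom_comp _ _ _ _ (mul_inv_cancel P))

variable (α : SL(2, k))

/-- The endomorphism `(X, Y) ↦ (X Y X⁻¹, X⁻¹)` of `S_α`. -/
noncomputable def rotate : Coord α →ₐ[k] Coord α :=
  lift ![pair α 0 * pair α 1 * (pair α 0)⁻¹, (pair α 0)⁻¹] (by
    rw [← pair_comm α]
    simp only [cons_val_zero, cons_val_one]
    group)

/-- The endomorphism `(X, Y) ↦ (Y⁻¹, Y X Y⁻¹)` of `S_α`. -/
noncomputable def rotateInv : Coord α →ₐ[k] Coord α :=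
  lift ![(pair α 1)⁻¹, pair α 1 * pair α 0 * (pair α 1)⁻¹] (by
    rw [← pair_comm α]
    simp only [cons_val_zero, cons_val_one]
    group)

/-- The endomorphism `(X, Y) ↦ (X, Y X)` of `S_α`. -/
noncomputable def twistRight : Coord α →ₐ[k] Coord α :=
  lift ![pair α 0, pair α 1 * pair α 0] (by
    rw [← pair_comm α]
    simp only [cons_val_zero, cons_val_one]
    group)

/-- The endomorphism `(X, Y) ↦ (X, Y X⁻¹)` of `S_α`. -/
noncomputable def twistRightInv : Coord α →ₐ[k] Coord α :=
  lift ![pair α 0, pair α 1 * (pair α 0)⁻¹] (by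
    rw [← pair_comm α]
    simp only [cons_val_zero, cons_val_one]
    group)

/-- The endomorphism `(X, Y) ↦ (X Y, Y)` of `S_α`. -/
noncomputable def twistLeft : Coord α →ₐ[k] Coord α :=
  lift ![pair α 0 * pair α 1, pair α 1] (by
    rw [← pair_comm α]
    simp only [cons_val_zero, cons_val_one]
    group)

/-- The endomorphism `(X, Y) ↦ (X Y⁻¹, Y)` of `S_α`. -/
noncomputable def twistLeftInv : Coord α →ₐ[k] Coord α :=
  lift ![pair α 0 * (pair α 1)⁻¹, pair α 1] (by
    rw [← pair_comm α]
    simp only [cons_val_zero, cons_val_one]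
    group)

/-- Composition in this order suffices, since moving a chart by `NoZeroDivisorsAway.of_map` uses
only a right inverse. -/
lemma rotate_comp : (rotate α).comp (rotateInv α) = AlgHom.id k _ := by
  refine algHom_ext' fun l => ?_
  rw [map_comp_pair, map_id_pair, rotateInv, map_lift]
  fin_cases l <;> simp [rotate, map_lift, mul_assoc]

lemma twistRight_comp : (twistRight α).comp (twistRightInv α) = AlgHom.id k _ := by
  refine algHom_ext' fun l => ?_
  rw [map_comp_pair, map_id_pair, twistRightInv, map_lift]
  fin_cases l <;> simp [twistRight, map_lift, mul_assoc]

lemma twistLeft_comp : (twistLeft α).comp (twistLeftInv α) = AlgHom.id k _ := by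
  refine algHom_ext' fun l => ?_
  rw [map_comp_pair, map_id_pair, twistLeftInv, map_lift]
  fin_cases l <;> simp [twistLeft, map_lift, mul_assoc]

/-- The endomorphism `(X, Y) ↦ (X, -Y)` of `S_α`. -/
noncomputable def negRight : Coord α →ₐ[k] Coord α :=
  lift ![pair α 0, -pair α 1] (by
    rw [← pair_comm α]
    apply Subtype.ext
    simp)

lemma negRight_comp : (negRight α).comp (negRight α) = AlgHom.id k _ := by
  refine algHom_ext fun l i j => ?_
  change negRight α (negRight α ((pair α l).1 i j)) = (pair α l).1 i j
  rw [negRight, lift_pair]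
  fin_cases l <;> simp [lift_pair]

/-- The endomorphism `(X, Y) ↦ (Y, X)` of `S_{-I}`. -/
noncomputable def swap : Coord (-1 : SL(2, k)) →ₐ[k] Coord (-1 : SL(2, k)) :=
  lift ![pair (-1) 1, pair (-1) 0] (by
    -- Exchanging `X` and `Y` inverts the commutator, and `-I` is its own inverse.
    have h := congrArg (·⁻¹) (pair_comm (-1 : SL(2, k)))
    rw [← map_inv] at h
    simp only [cons_val_zero, cons_val_one]
    convert h using 1
    · group
    · congr 1
      rw [eq_inv_iff_mul_eq_one]
      simp)

lemma swap_comp : (swap (k := k)).comp swap = AlgHom.id k _ := by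
  refine algHom_ext' fun l => ?_
  rw [map_comp_pair, map_id_pair]
  nth_rw 2 [swap]
  rw [map_lift]
  fin_cases l <;> simp [swap, map_lift]

end Symmetries

/-! ### Matrix equations in terms of entries -/

section Entries

variable {R : Type*} [CommRing R]

/-- The element of `SL(2)` with given entries. -/
def mkSL (a b c d : R) (h : a * d - b * c = 1) : SL(2, R) :=
  ⟨!![a, b; c, d], by rw [det_fin_two_of, h]⟩

lemma det_entries (X : SL(2, R)) : X.1 0 0 * X.1 1 1 - X.1 0 1 * X.1 1 0 = 1 := by
  rw [← det_fin_two, X.2]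

lemma inv_entries (X : SL(2, R)) : X⁻¹.1 = !![X.1 1 1, -X.1 0 1; -X.1 1 0, X.1 0 0] :=
  (Matrix.SpecialLinearGroup.coe_inv X).trans (adjugate_fin_two _)

lemma mul_entries (X Y : SL(2, R)) (i j : Fin 2) :
    (X * Y).1 i j = X.1 i 0 * Y.1 0 j + X.1 i 1 * Y.1 1 j :=
  (Matrix.mul_apply (M := X.1) (N := Y.1)).trans (Fin.sum_univ_two _)

lemma commutator_eq_iff_entries (X Y B : SL(2, R)) :
    X * Y * X⁻¹ * Y⁻¹ = B ↔
      X.1 0 0 * Y.1 0 0 + X.1 0 1 * Y.1 1 0 =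
        B.1 0 0 * (Y.1 0 0 * X.1 0 0 + Y.1 0 1 * X.1 1 0) +
          B.1 0 1 * (Y.1 1 0 * X.1 0 0 + Y.1 1 1 * X.1 1 0) ∧
      X.1 0 0 * Y.1 0 1 + X.1 0 1 * Y.1 1 1 =
        B.1 0 0 * (Y.1 0 0 * X.1 0 1 + Y.1 0 1 * X.1 1 1) +
          B.1 0 1 * (Y.1 1 0 * X.1 0 1 + Y.1 1 1 * X.1 1 1) ∧
      X.1 1 0 * Y.1 0 0 + X.1 1 1 * Y.1 1 0 =
        B.1 1 0 * (Y.1 0 0 * X.1 0 0 + Y.1 0 1 * X.1 1 0) +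
          B.1 1 1 * (Y.1 1 0 * X.1 0 0 + Y.1 1 1 * X.1 1 0) ∧
      X.1 1 0 * Y.1 0 1 + X.1 1 1 * Y.1 1 1 =
        B.1 1 0 * (Y.1 0 0 * X.1 0 1 + Y.1 0 1 * X.1 1 1) +
          B.1 1 1 * (Y.1 1 0 * X.1 0 1 + Y.1 1 1 * X.1 1 1) := by
  rw [commutator_eq_iff, ← Matrix.ext_iff]
  simp [Fin.forall_fin_two, Matrix.mul_apply, Fin.sum_univ_two, and_assoc]

variable {k : Type u} [Field k] [Algebra k R] {α : SL(2, k)}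

lemma algHom_ext_entries {φ ψ : Coord α →ₐ[k] R}
    (h₀₀ : φ ((pair α 0).1 0 0) = ψ ((pair α 0).1 0 0))
    (h₀₁ : φ ((pair α 0).1 0 1) = ψ ((pair α 0).1 0 1))
    (h₁₀ : φ ((pair α 0).1 1 0) = ψ ((pair α 0).1 1 0))
    (h₁₁ : φ ((pair α 0).1 1 1) = ψ ((pair α 0).1 1 1))
    (h₀₀' : φ ((pair α 1).1 0 0) = ψ ((pair α 1).1 0 0))
    (h₀₁' : φ ((pair α 1).1 0 1) = ψ ((pair α 1).1 0 1))
    (h₁₀' : φ ((pair α 1).1 1 0) = ψ ((pair α 1).1 1 0))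
    (h₁₁' : φ ((pair α 1).1 1 1) = ψ ((pair α 1).1 1 1)) : φ = ψ := by
  refine algHom_ext fun l i j => ?_
  fin_cases l <;> fin_cases i <;> fin_cases j <;> assumption

/-- The Jordan block `ε (1 + E₁₂)` with `ε² = 1`. -/
def jordan (ε : k) (h : ε * ε = 1) : SL(2, k) := mkSL ε ε 0 ε (by rw [h, mul_zero, sub_zero])

lemma commutator_eq_jordan_iff (X Y : SL(2, R)) (ε : k) (hε : ε * ε = 1) :
    X * Y * X⁻¹ * Y⁻¹ = SpecialLinearGroup.map (algebraMap k R) (jordan ε hε) ↔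
      X.1 0 0 * Y.1 0 0 + X.1 0 1 * Y.1 1 0 =
        algebraMap k R ε * (Y.1 0 0 * X.1 0 0 + Y.1 0 1 * X.1 1 0) +
          algebraMap k R ε * (Y.1 1 0 * X.1 0 0 + Y.1 1 1 * X.1 1 0) ∧
      X.1 0 0 * Y.1 0 1 + X.1 0 1 * Y.1 1 1 =
        algebraMap k R ε * (Y.1 0 0 * X.1 0 1 + Y.1 0 1 * X.1 1 1) +
          algebraMap k R ε * (Y.1 1 0 * X.1 0 1 + Y.1 1 1 * X.1 1 1) ∧
      X.1 1 0 * Y.1 0 0 + X.1 1 1 * Y.1 1 0 =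
        algebraMap k R ε * (Y.1 1 0 * X.1 0 0 + Y.1 1 1 * X.1 1 0) ∧
      X.1 1 0 * Y.1 0 1 + X.1 1 1 * Y.1 1 1 =
        algebraMap k R ε * (Y.1 1 0 * X.1 0 1 + Y.1 1 1 * X.1 1 1) := by
  rw [commutator_eq_iff_entries]
  have h00 : (SpecialLinearGroup.map (algebraMap k R) (jordan ε hε)).1 0 0 = algebraMap k R ε := rfl
  have h01 : (SpecialLinearGroup.map (algebraMap k R) (jordan ε hε)).1 0 1 = algebraMap k R ε := rfl
  have h10 : (SpecialLinearGroup.map (algebraMap k R) (jordan ε hε)).1 1 0 = 0 :=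
    map_zero (algebraMap k R)
  have h11 : (SpecialLinearGroup.map (algebraMap k R) (jordan ε hε)).1 1 1 = algebraMap k R ε := rfl
  rw [h00, h01, h10, h11, zero_mul, zero_mul, zero_add, zero_add]

/-- A polynomial ring injects into its localization at `g ≠ 0`, so `v` may be a zero of `g`. -/
lemma algebraMap_ne_zero_of_eval {σ : Type*} {g p : MvPolynomial σ k} (hg : g ≠ 0) (v : σ → k)
    (hp : MvPolynomial.eval v p ≠ 0) : algebraMap _ (Localization.Away g) p ≠ 0 := by
  intro h
  have := IsLocalization.injective (Localization.Away g)
    (powers_le_nonZeroDivisors_of_noZeroDivisors hg) (h.trans (map_zero _).symm)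
  exact hp (by rw [this, map_zero])

end Entries

/-! ### Jordan block with eigenvalue 1 -/

section Unipotent

variable {k : Type u} [Field k]

/-- Elements of `SL(2)` whose commutator is the standard unipotent element are upper triangular. -/
lemma unipotent_relations {R : Type*} [CommRing R] {a b c d e f g h : R}
    (hX : a * d - b * c = 1) (hY : e * h - f * g = 1)
    (h₁ : a * e + b * g = (e * a + f * c) + (g * a + h * c))
    (h₂ : a * f + b * h = (e * b + f * d) + (g * b + h * d))
    (h₃ : c * e + d * g = g * a + h * c)
    (h₄ : c * f + d * h = g * b + h * d) :
    c = 0 ∧ g = 0 ∧ f * e * (a ^ 2 - 1) + b * a * (1 - e ^ 2) = 1 := by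
  have hcf : c * f = g * b := by linear_combination h₄
  have hg1 : g * a + h * c = 0 := by linear_combination -h₁ - hcf
  have hg2 : c * e + d * g = 0 := by linear_combination h₃ + hg1
  -- The vanishing of `g` and `c` follows from polynomial identities over any commutative ring, so
  -- it holds in the coordinate ring before that ring is known to be reduced.
  have hg : g = 0 := by
    linear_combination c * h₂ - (a - d) * hcf + (d - b) * hg1 + b * hg2 - g * hX
  have hc : c = 0 := by
    subst hg
    linear_combination -c * hY + e * hg1
  subst hc hg
  refine ⟨rfl, rfl, ?_⟩
  -- This is the upper right entry `h₂` multiplied by `a e`, where `a` and `e` have inverses `d` and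
  -- `h`.
  linear_combination a * e * h₂ + (f * e + e * h) * hX + (1 - a * b) * hY

/-- The variety of pairs with unipotent commutator is rational. -/
theorem hasAffineChart_unipotent [CharZero k] :
    HasAffineChart k (Coord (jordan (1 : k) (mul_one 1))) 3 := by
  set α := jordan (1 : k) (mul_one 1) with hα
  have hX := det_entries (pair α 0)
  have hY := det_entries (pair α 1)
  obtain ⟨h₁, h₂, h₃, h₄⟩ := (commutator_eq_jordan_iff _ _ _ _).1 (pair_comm α)
  simp only [map_one, one_mul] at h₁ h₂ h₃ h₄
  obtain ⟨hc, hg, hp⟩ := unipotent_relations hX hY h₁ h₂ h₃ h₄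
  rw [hc, mul_zero, sub_zero] at hX
  rw [hg, mul_zero, sub_zero] at hY
  clear h₁ h₂ h₃ h₄
  -- The coordinates are the upper left entries `x` of `X` and `y` of `Y`, and the upper right entry
  -- `q` of `Y`. Where `1 - y²` is invertible, the remaining relation determines the upper right
  -- entry `p` of `X`.
  let g : MvPolynomial (Fin 3) k := .X 0 * .X 1 * (1 - .X 1 ^ 2)
  have hg0 : g ≠ 0 := by
    intro h
    have := congrArg (MvPolynomial.eval ![1, 2, 0]) h
    norm_num [g] at this
  let f : Coord α := 1 - (pair α 1).1 0 0 ^ 2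
  let M := Localization.Away f
  let L := Localization.Away g
  obtain ⟨w, hw⟩ := (IsLocalization.Away.algebraMap_isUnit (S := L) g).exists_right_inv
  obtain ⟨x, hx⟩ : ∃ x, x = algebraMap (MvPolynomial (Fin 3) k) L (.X 0) := ⟨_, rfl⟩
  obtain ⟨y, hy⟩ : ∃ y, y = algebraMap (MvPolynomial (Fin 3) k) L (.X 1) := ⟨_, rfl⟩
  obtain ⟨q, hq⟩ : ∃ q, q = algebraMap (MvPolynomial (Fin 3) k) L (.X 2) := ⟨_, rfl⟩
  have hw' : x * y * (1 - y ^ 2) * w = 1 := by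
    simpa only [g, map_mul, map_sub, map_pow, map_one, ← hx, ← hy] using hw
  obtain ⟨x', hx'⟩ : ∃ x', x * x' = 1 := ⟨y * (1 - y ^ 2) * w, by linear_combination hw'⟩
  obtain ⟨y', hy'⟩ : ∃ y', y * y' = 1 := ⟨x * (1 - y ^ 2) * w, by linear_combination hw'⟩
  obtain ⟨r, hr⟩ : ∃ r, (1 - y ^ 2) * r = 1 := ⟨x * y * w, by linear_combination hw'⟩
  let p : L := (1 - q * y * (x ^ 2 - 1)) * x' * r
  let φ : Coord α →ₐ[k] L := lift
    ![mkSL x p 0 x' (by linear_combination hx'), mkSL y q 0 y' (by linear_combination hy')] (by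
    rw [hα, commutator_eq_jordan_iff]
    refine ⟨?_, ?_, ?_, ?_⟩ <;> simp only [map_one, one_mul]
    · change x * y + p * 0 = (y * x + q * 0) + (0 * x + y' * 0)
      ring
    · change x * q + p * y' = (y * p + q * x') + (0 * p + y' * x')
      linear_combination ((1 - q * y * (x ^ 2 - 1)) * x' * r * y - q * (x ^ 2 - 1) * x') * hy' +
        (1 - q * y * (x ^ 2 - 1)) * x' * y' * hr - q * x * hx'
    · change 0 * y + x' * 0 = 0 * x + y' * 0
      ring
    · change 0 * q + x' * y' = 0 * p + y' * x'
      ring)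
  have hφ00 : φ ((pair α 0).1 0 0) = x := lift_pair _ _ _ _ _
  have hφ01 : φ ((pair α 0).1 0 1) = p := lift_pair _ _ _ _ _
  have hφ10 : φ ((pair α 0).1 1 0) = 0 := lift_pair _ _ _ _ _
  have hφ11 : φ ((pair α 0).1 1 1) = x' := lift_pair _ _ _ _ _
  have hφ00' : φ ((pair α 1).1 0 0) = y := lift_pair _ _ _ _ _
  have hφ01' : φ ((pair α 1).1 0 1) = q := lift_pair _ _ _ _ _
  have hφ10' : φ ((pair α 1).1 1 0) = 0 := lift_pair _ _ _ _ _
  have hφ11' : φ ((pair α 1).1 1 1) = y' := lift_pair _ _ _ _ _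
  have hφf : φ f = 1 - y ^ 2 := by simp only [f, map_sub, map_one, map_pow, hφ00']
  have hrot : rotate α f = 1 - (pair α 0).1 1 1 ^ 2 := by
    have : rotate α ((pair α 1).1 0 0) = (pair α 0).1 1 1 := by
      rw [rotate, lift_pair, cons_val_one, cons_val_zero, inv_entries]
      rfl
    simp only [f, map_sub, map_one, map_pow, this]
  let m : Coord α →+* M := algebraMap (Coord α) M
  let ψ : MvPolynomial (Fin 3) k →ₐ[k] M := MvPolynomial.aeval
    ![m ((pair α 0).1 0 0), m ((pair α 1).1 0 0), m ((pair α 1).1 0 1)]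
  have hψ0 : ψ (.X 0) = m ((pair α 0).1 0 0) := MvPolynomial.aeval_X _ _
  have hψ1 : ψ (.X 1) = m ((pair α 1).1 0 0) := MvPolynomial.aeval_X _ _
  have hψ2 : ψ (.X 2) = m ((pair α 1).1 0 1) := MvPolynomial.aeval_X _ _
  have mX := congrArg m hX
  have mY := congrArg m hY
  have mp := congrArg m hp
  simp only [map_mul, map_sub, map_add, map_pow, map_one] at mX mY mp
  have hmf : IsUnit (m f) := IsLocalization.Away.algebraMap_isUnit f
  have hmf' : m f = 1 - m ((pair α 1).1 0 0) ^ 2 := by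
    simp only [f, map_sub, map_one, map_pow]
  refine HasAffineChart.of_translates (f := f) hg0 (nonempty_chart f g φ ψ ?_ ?_ ?_ ?_) φ
    (s := {f, rotate α f}) (by simp) ?_ ?_ ?_
  · refine IsUnit.of_mul_eq_one r ?_
    rw [hφf, hr]
  · simp only [g, map_mul, map_sub, map_one, map_pow, hψ0, hψ1]
    rw [← hmf']
    exact ((IsUnit.of_mul_eq_one _ mX).mul (IsUnit.of_mul_eq_one _ mY)).mul hmf
  · intro χ hχ
    have hχx : χ x = m ((pair α 0).1 0 0) := by rw [hx, hχ, hψ0]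
    have hχy : χ y = m ((pair α 1).1 0 0) := by rw [hy, hχ, hψ1]
    have hχq : χ q = m ((pair α 1).1 0 1) := by rw [hq, hχ, hψ2]
    have hχx' := congrArg χ hx'
    have hχy' := congrArg χ hy'
    have hχr := congrArg χ hr
    simp only [map_mul, map_sub, map_pow, map_one, hχx, hχy] at hχx' hχy' hχr
    apply algHom_ext_entries
    · change χ (φ _) = m _
      rw [hφ00, hχx]
    · change χ (φ _) = m _
      rw [hφ01]
      simp only [p, map_mul, map_sub, map_pow, map_one, hχx, hχy, hχq]
      linear_combination -χ x' * χ r * mp +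
        m ((pair α 0).1 0 1) * (1 - m ((pair α 1).1 0 0) ^ 2) * χ r * hχx' +
        m ((pair α 0).1 0 1) * hχr
    · change χ (φ _) = m _
      rw [hφ10, hc, map_zero, map_zero]
    · change χ (φ _) = m _
      rw [hφ11]
      linear_combination m ((pair α 0).1 1 1) * hχx' - χ x' * mX
    · change χ (φ _) = m _
      rw [hφ00', hχy]
    · change χ (φ _) = m _
      rw [hφ01', hχq]
    · change χ (φ _) = m _
      rw [hφ10', hg, map_zero, map_zero]
    · change χ (φ _) = m _
      rw [hφ11']
      linear_combination m ((pair α 1).1 1 1) * hχy' - χ y' * mY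
  · intro χ hχ i
    have hχ' : ∀ a, χ (m a) = φ a := hχ
    fin_cases i
    · change χ (ψ (.X 0)) = algebraMap (MvPolynomial (Fin 3) k) L (.X 0)
      rw [hψ0, hχ', hφ00, hx]
    · change χ (ψ (.X 1)) = algebraMap (MvPolynomial (Fin 3) k) L (.X 1)
      rw [hψ1, hχ', hφ00', hy]
    · change χ (ψ (.X 2)) = algebraMap (MvPolynomial (Fin 3) k) L (.X 2)
      rw [hψ2, hχ', hφ01', hq]
  · rw [Ideal.eq_top_iff_one, Ideal.mem_span_pair]
    -- Since `a d = 1`, one has `a² - 1 = a² (1 - d²)`, which turns the relation `hp` into a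
    -- combination of `f = 1 - e²` and `rotate α f = 1 - d²`.
    refine ⟨(pair α 0).1 0 1 * (pair α 0).1 0 0,
      (pair α 1).1 0 1 * (pair α 1).1 0 0 * (pair α 0).1 0 0 ^ 2, ?_⟩
    rw [hrot]
    linear_combination hp - (pair α 1).1 0 1 * (pair α 1).1 0 0 *
      ((pair α 0).1 0 0 * (pair α 0).1 1 1 + 1) * hX
  · rintro a (rfl | rfl)
    · exact ⟨AlgHom.id k _, AlgHom.id k _, rfl, rfl⟩
    · exact ⟨rotate α, rotateInv α, rotate_comp α, rfl⟩
  · rintro a (rfl | rfl)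
    · have := algebraMap_ne_zero_of_eval hg0 0
        (p := 1 - MvPolynomial.X 1 ^ 2) (by simp)
      rwa [map_sub, map_one, map_pow, ← hy, ← hφf] at this
    · intro h0
      have := algebraMap_ne_zero_of_eval hg0 0
        (p := MvPolynomial.X 0 ^ 2 - 1) (by simp)
      rw [map_sub, map_one, map_pow, ← hx] at this
      apply this
      rw [hrot, map_sub, map_pow, map_one, hφ11] at h0
      linear_combination x ^ 2 * h0 + (x * x' + 1) * hx'

end Unipotent

/-! ### Jordan block with eigenvalue -1 and the Markov-type cubic -/

section NegativeUnipotent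

variable {k : Type u} [Field k]

/-- Relations between the entries of two elements of `SL(2)` whose commutator is the Jordan block
with eigenvalue `-1`. -/
lemma jordan_neg_one_relations {R : Type*} [CommRing R] {a b c d e f g h j : R} (hj : 2 * j = 1)
    (hX : a * d - b * c = 1) (hY : e * h - f * g = 1)
    (h₁ : a * e + b * g = -1 * (e * a + f * c) + -1 * (g * a + h * c))
    (h₂ : a * f + b * h = -1 * (e * b + f * d) + -1 * (g * b + h * d))
    (h₃ : c * e + d * g = -1 * (g * a + h * c))
    (h₄ : c * f + d * h = -1 * (g * b + h * d)) :
    c = 2 * (a + d) ∧ g = -2 * (e + h) ∧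
    (a + d) * h = (e + h) * a - (a * e + b * g + c * f + d * h) ∧
    (a + d) * f = (e + h) * b - d * h ∧
    (a + d) ^ 2 + (e + h) ^ 2 + (a * e + b * g + c * f + d * h) ^ 2 =
      (a + d) * (e + h) * (a * e + b * g + c * f + d * h) ∧
    (a + d) * (-a * e * f - 2 * b + 4 * (e + h) * b * f) + (e + h) * (a * e * b + 2 * f) = 1 := by
  -- Traces of `Y X Y⁻¹ = α⁻¹ X`, and for `hg` of `X Y X⁻¹ = α Y`, where `α = -(1 + E₁₂)`.
  have hc : c = 2 * (a + d) := by
    linear_combination -h * (h₁ - h₃) + g * (h₂ - h₄) + f * h₃ - e * h₄ + (2 * (a + d) - c) * hY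
  have hg : g = -2 * (e + h) := by
    linear_combination d * h₁ - c * h₂ - b * h₃ + a * h₄ - (2 * (e + h) + g) * hX
  have hδ : (a + d) * h = (e + h) * a - (a * e + b * g + c * f + d * h) := by
    linear_combination h₄
  have hε : (a + d) * f = (e + h) * b - d * h := by
    linear_combination j * h₄ - j * f * hc - j * b * hg -
      ((a + d) * f - (e + h) * b + d * h) * hj
  have hκ : a * d - 2 * (a + d) * b = 1 := by linear_combination hX + b * hc
  have hY' : e * h + 2 * (e + h) * f = 1 := by linear_combination hY + f * hg
  refine ⟨hc, hg, hδ, hε, ?_, ?_⟩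
  -- The relation is Fricke's identity `tr [X, Y] = t² + s² + w² - t s w - 2` for commutator trace
  -- `-2`.
  · linear_combination -(a + d) ^ 2 * hY' + ((a + d) * (e + h) - (a + d) * h -
      ((e + h) * a - (a * e + b * g + c * f + d * h)) - 2 * (e + h) * d) * hδ +
      2 * (e + h) * (a + d) * hε - (e + h) ^ 2 * hκ
  · linear_combination -a * e * h₂ + a * e * b * hg + (1 - 2 * (e + h) * f) * hκ + a * d * hY'

lemma two_mul_algebraMap_inv_two (k R : Type*) [Field k] [CharZero k] [CommRing R] [Algebra k R] :
    2 * algebraMap k R 2⁻¹ = 1 := by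
  rw [← map_ofNat (algebraMap k R) 2, ← map_mul, mul_inv_cancel₀ two_ne_zero, map_one]

section Traces

variable (α : SL(2, k))

/-- The function `tr X`. -/
noncomputable def traceX : Coord α := (pair α 0).1 0 0 + (pair α 0).1 1 1

/-- The function `tr Y`. -/
noncomputable def traceY : Coord α := (pair α 1).1 0 0 + (pair α 1).1 1 1

/-- The function `tr (X Y)`. -/
noncomputable def traceXY : Coord α :=
  (pair α 0).1 0 0 * (pair α 1).1 0 0 + (pair α 0).1 0 1 * (pair α 1).1 1 0 +
    (pair α 0).1 1 0 * (pair α 1).1 0 1 + (pair α 0).1 1 1 * (pair α 1).1 1 1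

/-- Since `tr (X⁻¹ Y) = t s - w`, the substitution sends `(t, s, w)` to `(s, t, t s - w)`: a Vieta
move on the cubic, up to order. The two twists give the moves in the other variables. -/
lemma rotate_trace : rotate α (traceX α * traceY α * traceXY α) =
    traceY α * traceX α * (traceX α * traceY α - traceXY α) := by
  have hX := det_entries (pair α 0)
  have h0 : ∀ i j, rotate α ((pair α 0).1 i j) = (pair α 0 * pair α 1 * (pair α 0)⁻¹).1 i j :=
    fun i j => lift_pair _ _ 0 i j
  have h1 : ∀ i j, rotate α ((pair α 1).1 i j) = (pair α 0)⁻¹.1 i j :=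
    fun i j => lift_pair _ _ 1 i j
  have e1 : rotate α (traceX α) = traceY α := by
    simp only [traceX, traceY, map_add, h0, mul_entries, inv_entries, of_apply, cons_val',
      cons_val_zero, cons_val_one, cons_val_fin_one]
    linear_combination ((pair α 1).1 0 0 + (pair α 1).1 1 1) * hX
  have e2 : rotate α (traceY α) = traceX α := by
    simp only [traceX, traceY, map_add, h1, inv_entries, of_apply, cons_val',
      cons_val_zero, cons_val_one, cons_val_fin_one]
    ring
  have e3 : rotate α (traceXY α) = traceX α * traceY α - traceXY α := by
    simp only [traceX, traceY, traceXY, map_add, map_mul, h0, h1, mul_entries, inv_entries,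
      of_apply, cons_val', cons_val_zero, cons_val_one, cons_val_fin_one]
    linear_combination ((pair α 1).1 0 0 * (pair α 0).1 1 1 - (pair α 1).1 0 1 * (pair α 0).1 1 0 -
      (pair α 1).1 1 0 * (pair α 0).1 0 1 + (pair α 1).1 1 1 * (pair α 0).1 0 0) * hX
  rw [map_mul, map_mul, e1, e2, e3]

lemma twistRight_trace : twistRight α (traceX α * traceY α * traceXY α) =
    traceX α * traceXY α * (traceX α * traceXY α - traceY α) := by
  have hX := det_entries (pair α 0)
  have h0 : ∀ i j, twistRight α ((pair α 0).1 i j) = (pair α 0).1 i j :=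
    fun i j => lift_pair _ _ 0 i j
  have h1 : ∀ i j, twistRight α ((pair α 1).1 i j) = (pair α 1 * pair α 0).1 i j :=
    fun i j => lift_pair _ _ 1 i j
  have e1 : twistRight α (traceX α) = traceX α := by
    simp only [traceX, map_add, h0]
  have e2 : twistRight α (traceY α) = traceXY α := by
    simp only [traceXY, traceY, map_add, h1, mul_entries]
    ring
  have e3 : twistRight α (traceXY α) = traceX α * traceXY α - traceY α := by
    simp only [traceX, traceY, traceXY, map_add, map_mul, h0, h1, mul_entries]
    linear_combination -((pair α 1).1 0 0 + (pair α 1).1 1 1) * hX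
  rw [map_mul, map_mul, e1, e2, e3]

lemma twistLeft_trace : twistLeft α (traceX α * traceY α * traceXY α) =
    traceXY α * traceY α * (traceY α * traceXY α - traceX α) := by
  have hY := det_entries (pair α 1)
  have h0 : ∀ i j, twistLeft α ((pair α 0).1 i j) = (pair α 0 * pair α 1).1 i j :=
    fun i j => lift_pair _ _ 0 i j
  have h1 : ∀ i j, twistLeft α ((pair α 1).1 i j) = (pair α 1).1 i j :=
    fun i j => lift_pair _ _ 1 i j
  have e1 : twistLeft α (traceX α) = traceXY α := by
    simp only [traceX, traceXY, map_add, h0, mul_entries]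
    ring
  have e2 : twistLeft α (traceY α) = traceY α := by
    simp only [traceY, map_add, h1]
  have e3 : twistLeft α (traceXY α) = traceY α * traceXY α - traceX α := by
    simp only [traceX, traceY, traceXY, map_add, map_mul, h0, h1, mul_entries]
    linear_combination -((pair α 0).1 0 0 + (pair α 0).1 1 1) * hY
  rw [map_mul, map_mul, e1, e2, e3]

end Traces

/-- If `(t, s)` is the unit ideal and `t² + s² + w² = t s w`, then the four functions below have
no common zero. -/
lemma span_markov_eq_top {R : Type*} [CommRing R] {t s w A B : R}
    (hm : t ^ 2 + s ^ 2 + w ^ 2 = t * s * w) (h1 : t * A + s * B = 1) :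
    Ideal.span {t * s * w, s * t * (t * s - w), t * w * (t * w - s), w * s * (s * w - t)} = ⊤ := by
  set J : Ideal R :=
    Ideal.span {t * s * w, s * t * (t * s - w), t * w * (t * w - s), w * s * (s * w - t)} with hJ
  have m0 : t * s * w ∈ J := Ideal.subset_span (by simp)
  have m1 : s * t * (t * s - w) ∈ J := Ideal.subset_span (by simp)
  have m2 : t * w * (t * w - s) ∈ J := Ideal.subset_span (by simp)
  have m3 : w * s * (s * w - t) ∈ J := Ideal.subset_span (by simp)
  have ht : t ^ 4 ∈ J := by
    -- The cubic times `t²` gives `t⁴ = t² · t s w - t² (s² + w²)`, and `t² (s² + w²)` is the sum of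
    -- the second and third generators plus `2 t s w`.
    have e : t ^ 4 = (t ^ 2 - 2) * (t * s * w) - s * t * (t * s - w) - t * w * (t * w - s) := by
      linear_combination t ^ 2 * hm
    rw [e]
    exact J.sub_mem (J.sub_mem (J.mul_mem_left _ m0) m1) m2
  have hs : s ^ 4 ∈ J := by
    have e : s ^ 4 = (s ^ 2 - 2) * (t * s * w) - s * t * (t * s - w) - w * s * (s * w - t) := by
      linear_combination s ^ 2 * hm
    rw [e]
    exact J.sub_mem (J.sub_mem (J.mul_mem_left _ m0) m1) m3
  have htop : Ideal.span {t, s} = (⊤ : Ideal R) := by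
    rw [Ideal.eq_top_iff_one, Ideal.mem_span_pair]
    exact ⟨A, B, by linear_combination h1⟩
  refine top_unique ((Ideal.span_pow_eq_top _ htop 4).ge.trans (Ideal.span_le.2 ?_))
  rintro _ ⟨x, rfl | rfl, rfl⟩
  exacts [ht, hs]

set_option maxHeartbeats 1000000 in
/-- The variety of pairs whose commutator is a Jordan block with eigenvalue `-1` is rational. -/
theorem hasAffineChart_jordan_neg_one [CharZero k] (hε : (-1 : k) * -1 = 1) :
    HasAffineChart k (Coord (jordan (-1 : k) hε)) 3 := by
  set α := jordan (-1 : k) hε with hα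
  have hX := det_entries (pair α 0)
  have hY := det_entries (pair α 1)
  obtain ⟨h₁, h₂, h₃, h₄⟩ := (commutator_eq_jordan_iff _ _ _ _).1 (pair_comm α)
  simp only [map_neg, map_one] at h₁ h₂ h₃ h₄
  obtain ⟨hc, hg, hH, hF, hM, h1⟩ := jordan_neg_one_relations
    (two_mul_algebraMap_inv_two k _) hX hY h₁ h₂ h₃ h₄
  clear h₁ h₂ h₃ h₄
  change _ = 2 * traceX α at hc
  change _ = -2 * traceY α at hg
  change traceX α * _ = traceY α * _ - traceXY α at hH
  change traceX α * _ = traceY α * _ - _ at hF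
  change traceX α ^ 2 + traceY α ^ 2 + traceXY α ^ 2 = traceX α * traceY α * traceXY α at hM
  -- The coordinates are `p = s / t`, `q = w / t` and the entry `a` of `X`. The cubic becomes `p q t
  -- = 1 + p² + q²`, so the third factor of `g` makes `t` invertible.
  let g : MvPolynomial (Fin 3) k := .X 0 * .X 1 * (1 + .X 0 ^ 2 + .X 1 ^ 2)
  have hg0 : g ≠ 0 := by
    intro h
    have := congrArg (MvPolynomial.eval ![1, 1, 0]) h
    norm_num [g] at this
  let f : Coord α := traceX α * traceY α * traceXY α
  let M := Localization.Away f
  let L := Localization.Away g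
  have : IsDomain L := isDomain_localizationAway hg0
  obtain ⟨i, hi⟩ := (IsLocalization.Away.algebraMap_isUnit (S := L) g).exists_right_inv
  obtain ⟨p, hp⟩ : ∃ x, x = algebraMap (MvPolynomial (Fin 3) k) L (.X 0) := ⟨_, rfl⟩
  obtain ⟨q, hq⟩ : ∃ y, y = algebraMap (MvPolynomial (Fin 3) k) L (.X 1) := ⟨_, rfl⟩
  obtain ⟨a, ha⟩ : ∃ q, q = algebraMap (MvPolynomial (Fin 3) k) L (.X 2) := ⟨_, rfl⟩
  have hi' : p * q * (1 + p ^ 2 + q ^ 2) * i = 1 := by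
    simpa only [g, map_mul, map_add, map_pow, map_one, ← hp, ← hq] using hi
  obtain ⟨T, hT⟩ : ∃ T, p * q * T = 1 + p ^ 2 + q ^ 2 :=
    ⟨(1 + p ^ 2 + q ^ 2) ^ 2 * i, by linear_combination (1 + p ^ 2 + q ^ 2) * hi'⟩
  obtain ⟨T', hT'⟩ : ∃ T', T * T' = 1 :=
    ⟨p ^ 2 * q ^ 2 * i, by linear_combination hi' + p * q * i * hT⟩
  obtain ⟨j, hj⟩ : ∃ j : L, 2 * j = 1 := ⟨_, two_mul_algebraMap_inv_two k L⟩
  -- With `c = 2T` and `d = T - a`, the determinant of `X` determines `b`. The entries of `Y` come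
  -- from `t h = s a - w` and `t f = s b - d h`, divided by `t`.
  let b : L := (a * (T - a) - 1) * j * T'
  let F : L := p * b - (T - a) * (p * a - q) * T'
  let φ : Coord α →ₐ[k] L := lift
    ![mkSL a b (2 * T) (T - a) (by
        linear_combination (-(a * (T - a) - 1)) * T * T' * hj - (a * (T - a) - 1) * hT'),
      mkSL (p * T - p * a + q) F (-2 * p * T) (p * a - q) (by
        linear_combination hT + p ^ 2 * (a * (T - a) - 1) * T * T' * hj +
          (p ^ 2 * (a * (T - a) - 1) - 2 * p * (T - a) * (p * a - q)) * hT')] (by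
    rw [hα, commutator_eq_jordan_iff]
    refine ⟨?_, ?_, ?_, ?_⟩ <;> simp only [map_neg, map_one]
    · change a * (p * T - p * a + q) + b * (-2 * p * T) =
        -1 * ((p * T - p * a + q) * a + F * (2 * T)) + -1 * ((-2 * p * T) * a + (p * a - q) * (2 * T))
      linear_combination -2 * (T - a) * (p * a - q) * hT'
    · change a * F + b * (p * a - q) =
        -1 * ((p * T - p * a + q) * b + F * (T - a)) + -1 * ((-2 * p * T) * b + (p * a - q) * (T - a))
      linear_combination -(T - a) * (p * a - q) * hT'
    · change 2 * T * (p * T - p * a + q) + (T - a) * (-2 * p * T) =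
        -1 * ((-2 * p * T) * a + (p * a - q) * (2 * T))
      ring
    · change 2 * T * F + (T - a) * (p * a - q) = -1 * ((-2 * p * T) * b + (p * a - q) * (T - a))
      linear_combination -2 * (T - a) * (p * a - q) * hT')
  have hφ00 : φ ((pair α 0).1 0 0) = a := lift_pair _ _ _ _ _
  have hφ01 : φ ((pair α 0).1 0 1) = b := lift_pair _ _ _ _ _
  have hφ10 : φ ((pair α 0).1 1 0) = 2 * T := lift_pair _ _ _ _ _
  have hφ11 : φ ((pair α 0).1 1 1) = T - a := lift_pair _ _ _ _ _
  have hφ00' : φ ((pair α 1).1 0 0) = p * T - p * a + q := lift_pair _ _ _ _ _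
  have hφ01' : φ ((pair α 1).1 0 1) = F := lift_pair _ _ _ _ _
  have hφ10' : φ ((pair α 1).1 1 0) = -2 * p * T := lift_pair _ _ _ _ _
  have hφ11' : φ ((pair α 1).1 1 1) = p * a - q := lift_pair _ _ _ _ _
  have hφt : φ (traceX α) = T := by
    rw [traceX, map_add, hφ00, hφ11]
    ring
  have hφs : φ (traceY α) = p * T := by
    rw [traceY, map_add, hφ00', hφ11']
    ring
  have hφw : φ (traceXY α) = q * T := by
    have := congrArg φ hH
    simp only [map_mul, map_sub, hφt, hφs, hφ00, hφ11'] at this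
    linear_combination this
  let m : Coord α →+* M := algebraMap (Coord α) M
  have hmf : IsUnit (m f) := IsLocalization.Away.algebraMap_isUnit f
  obtain ⟨n, hn⟩ := hmf.exists_right_inv
  simp only [f, map_mul] at hn
  obtain ⟨t', ht'⟩ : ∃ t', m (traceX α) * t' = 1 :=
    ⟨m (traceY α) * m (traceXY α) * n, by linear_combination hn⟩
  let ψ : MvPolynomial (Fin 3) k →ₐ[k] M := MvPolynomial.aeval
    ![m (traceY α) * t', m (traceXY α) * t', m ((pair α 0).1 0 0)]
  have hψ0 : ψ (.X 0) = m (traceY α) * t' := MvPolynomial.aeval_X _ _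
  have hψ1 : ψ (.X 1) = m (traceXY α) * t' := MvPolynomial.aeval_X _ _
  have hψ2 : ψ (.X 2) = m ((pair α 0).1 0 0) := MvPolynomial.aeval_X _ _
  have mX := congrArg m hX
  have mc := congrArg m hc
  have mg := congrArg m hg
  have mH := congrArg m hH
  have mF := congrArg m hF
  have mM := congrArg m hM
  have mt := congrArg m (show traceX α = (pair α 0).1 0 0 + (pair α 0).1 1 1 from rfl)
  have ms := congrArg m (show traceY α = (pair α 1).1 0 0 + (pair α 1).1 1 1 from rfl)
  simp only [map_mul, map_sub, map_add, map_neg, map_pow, map_one, map_ofNat]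
    at mX mc mg mH mF mM mt ms
  have hpu : IsUnit p := .of_mul_eq_one (q * (1 + p ^ 2 + q ^ 2) * i) (by linear_combination hi')
  have hqu : IsUnit q := .of_mul_eq_one (p * (1 + p ^ 2 + q ^ 2) * i) (by linear_combination hi')
  have hTu : IsUnit T := .of_mul_eq_one T' hT'
  refine HasAffineChart.of_translates (f := f) hg0 (nonempty_chart f g φ ψ ?_ ?_ ?_ ?_) φ
    (s := {f, rotate α f, twistRight α f, twistLeft α f}) (by simp) ?_ ?_ ?_
  · simp only [f, map_mul, hφt, hφs, hφw]
    exact (hTu.mul (hpu.mul hTu)).mul (hqu.mul hTu)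
  · have hψg : ψ g =
        m (traceY α) * m (traceXY α) * (m (traceX α) * m (traceY α) * m (traceXY α)) * t' ^ 4 := by
      simp only [g, map_mul, map_add, map_pow, map_one, hψ0, hψ1]
      linear_combination m (traceY α) * m (traceXY α) * t' ^ 2 *
        (t' ^ 2 * mM - (m (traceX α) * t' + 1) * ht')
    rw [hψg]
    exact ((IsUnit.of_mul_eq_one (m (traceX α) * n) (by linear_combination hn)).mul
      (IsUnit.of_mul_eq_one n hn)).mul
        ((IsUnit.of_mul_eq_one (m (traceX α)) (by linear_combination ht')).pow 4)
  · intro χ hχ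
    have hχp : χ p = m (traceY α) * t' := by rw [hp, hχ, hψ0]
    have hχq : χ q = m (traceXY α) * t' := by rw [hq, hχ, hψ1]
    have hχa : χ a = m ((pair α 0).1 0 0) := by rw [ha, hχ, hψ2]
    -- Clearing denominators in `p q T = 1 + p² + q²` gives `s w T = t² + s² + w² = t s w`, and `s`,
    -- `w` are units in `M`.
    have hχT : χ T = m (traceX α) := by
      have := congrArg χ hT
      simp only [map_mul, map_add, map_pow, map_one, hχp, hχq] at this
      linear_combination m (traceX α) ^ 3 * n * this -
        χ T * ((m (traceX α) * t') ^ 2 * hn + (m (traceX α) * t' + 1) * ht') +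
        m (traceX α) * n * (m (traceY α) ^ 2 + m (traceXY α) ^ 2) * (m (traceX α) * t' + 1) * ht' +
        m (traceX α) * n * mM + m (traceX α) * hn
    have hχT' : χ T' = t' := by
      have := congrArg χ hT'
      simp only [map_mul, map_one, hχT] at this
      linear_combination t' * this - χ T' * ht'
    have hχj : 2 * χ j = 1 := by
      have := congrArg χ hj
      rwa [map_mul, map_ofNat, map_one] at this
    have hχb : χ b = m ((pair α 0).1 0 1) := by
      simp only [b, map_mul, map_sub, map_one, hχT, hχT', hχa]
      linear_combination χ j * t' * (mX + m ((pair α 0).1 0 0) * mt + m ((pair α 0).1 0 1) * mc) +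
        m ((pair α 0).1 0 1) * m (traceX α) * t' * hχj + m ((pair α 0).1 0 1) * ht'
    apply algHom_ext_entries
    · change χ (φ _) = m _
      rw [hφ00, hχa]
    · change χ (φ _) = m _
      rw [hφ01, hχb]
    · change χ (φ _) = m _
      rw [hφ10, map_mul, map_ofNat, hχT, mc]
    · change χ (φ _) = m _
      rw [hφ11, map_sub, hχT, hχa, mt, add_sub_cancel_left]
    · change χ (φ _) = m _
      simp only [hφ00', map_add, map_sub, map_mul, hχp, hχq, hχT, hχa]
      linear_combination m (traceY α) * ht' + t' * mH - m ((pair α 1).1 1 1) * ht' + ms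
    · change χ (φ _) = m _
      simp only [hφ01', F, map_sub, map_mul, hχp, hχq, hχT, hχT', hχa, hχb]
      linear_combination -t' * mF + m ((pair α 1).1 0 1) * ht' -
        t' * (m (traceY α) * t' * m ((pair α 0).1 0 0) - m (traceXY α) * t') * mt -
        t' * m ((pair α 0).1 1 1) * (-t' * mH + m ((pair α 1).1 1 1) * ht')
    · change χ (φ _) = m _
      simp only [hφ10', map_neg, map_mul, map_ofNat, hχp, hχT, mg]
      linear_combination -2 * m (traceY α) * ht'
    · change χ (φ _) = m _
      simp only [hφ11', map_sub, map_mul, hχp, hχq, hχa]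
      linear_combination -t' * mH + m ((pair α 1).1 1 1) * ht'
  · intro χ hχ i
    have hχ' : ∀ a, χ (m a) = φ a := hχ
    have hχt := congrArg χ ht'
    simp only [map_mul, hχ', hφt, map_one] at hχt
    fin_cases i
    · change χ (ψ (.X 0)) = algebraMap (MvPolynomial (Fin 3) k) L (.X 0)
      rw [hψ0, map_mul, hχ', hφs, ← hp]
      linear_combination p * hχt
    · change χ (ψ (.X 1)) = algebraMap (MvPolynomial (Fin 3) k) L (.X 1)
      rw [hψ1, map_mul, hχ', hφw, ← hq]
      linear_combination q * hχt
    · change χ (ψ (.X 2)) = algebraMap (MvPolynomial (Fin 3) k) L (.X 2)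
      rw [hψ2, hχ', hφ00, ha]
  · simp only [f]
    rw [rotate_trace, twistRight_trace, twistLeft_trace]
    exact span_markov_eq_top hM h1
  · rintro a (rfl | rfl | rfl | rfl)
    · exact ⟨AlgHom.id k _, AlgHom.id k _, rfl, rfl⟩
    · exact ⟨rotate α, rotateInv α, rotate_comp α, rfl⟩
    · exact ⟨twistRight α, twistRightInv α, twistRight_comp α, rfl⟩
    · exact ⟨twistLeft α, twistLeftInv α, twistLeft_comp α, rfl⟩
  · have hp0 := hpu.ne_zero
    have hq0 := hqu.ne_zero
    have hT0 := hTu.ne_zero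
    have hne : ∀ P : MvPolynomial (Fin 3) k, ∀ v, MvPolynomial.eval v P ≠ 0 →
      algebraMap (MvPolynomial (Fin 3) k) L P ≠ 0 := fun P v =>
        algebraMap_ne_zero_of_eval hg0 v
    rintro a (rfl | rfl | rfl | rfl)
    · simp only [f, map_mul, hφt, hφs, hφw]
      exact mul_ne_zero (mul_ne_zero hT0 (mul_ne_zero hp0 hT0)) (mul_ne_zero hq0 hT0)
    · rw [rotate_trace]
      simp only [map_mul, map_sub, hφt, hφs, hφw]
      -- Vanishing of `t s - w` would mean `p T = q`, and then `hT` would force `1 + p² = 0`. The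
      -- other two translates lead likewise to `1 + q² = 0` and `p² + q² = 0`.
      refine mul_ne_zero (mul_ne_zero (mul_ne_zero hp0 hT0) hT0) fun h0 => ?_
      have := hne (1 + .X 0 ^ 2) 0 (by simp)
      rw [map_add, map_one, map_pow, ← hp] at this
      apply this
      linear_combination -hT + q * T' * h0 - (p * q * T - q ^ 2) * hT'
    · rw [twistRight_trace]
      simp only [map_mul, map_sub, hφt, hφs, hφw]
      refine mul_ne_zero (mul_ne_zero hT0 (mul_ne_zero hq0 hT0)) fun h0 => ?_
      have := hne (1 + .X 1 ^ 2) 0 (by simp)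
      rw [map_add, map_one, map_pow, ← hq] at this
      apply this
      linear_combination -hT + p * T' * h0 - (p * q * T - p ^ 2) * hT'
    · rw [twistLeft_trace]
      simp only [map_mul, map_sub, hφt, hφs, hφw]
      refine mul_ne_zero (mul_ne_zero (mul_ne_zero hq0 hT0) (mul_ne_zero hp0 hT0)) fun h0 => ?_
      have := hne (.X 0 ^ 2 + .X 1 ^ 2) ![1, 0, 0] (by simp)
      rw [map_add, map_pow, map_pow, ← hp, ← hq] at this
      apply this
      linear_combination -hT + T' * h0 - (p * q * T - 1) * hT'

end NegativeUnipotent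

/-! ### Anticommuting pairs and the conic -/

section NegOne

variable {k : Type u} [Field k]

lemma commutator_eq_neg_one_iff {R : Type*} [CommRing R] [Algebra k R] (X Y : SL(2, R)) :
    X * Y * X⁻¹ * Y⁻¹ = SpecialLinearGroup.map (algebraMap k R) (-1) ↔
      X.1 0 0 * Y.1 0 0 + X.1 0 1 * Y.1 1 0 = -(Y.1 0 0 * X.1 0 0 + Y.1 0 1 * X.1 1 0) ∧
      X.1 0 0 * Y.1 0 1 + X.1 0 1 * Y.1 1 1 = -(Y.1 0 0 * X.1 0 1 + Y.1 0 1 * X.1 1 1) ∧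
      X.1 1 0 * Y.1 0 0 + X.1 1 1 * Y.1 1 0 = -(Y.1 1 0 * X.1 0 0 + Y.1 1 1 * X.1 1 0) ∧
      X.1 1 0 * Y.1 0 1 + X.1 1 1 * Y.1 1 1 = -(Y.1 1 0 * X.1 0 1 + Y.1 1 1 * X.1 1 1) := by
  have h : ∀ i j, (SpecialLinearGroup.map (algebraMap k R) (-1)).1 i j =
      algebraMap k R ((-1 : Matrix (Fin 2) (Fin 2) k) i j) := fun i j => rfl
  rw [commutator_eq_iff_entries, h, h, h, h]
  simp

/-- Relations between the entries of two anticommuting elements of `SL(2)`. -/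
lemma neg_one_relations {R : Type*} [CommRing R] {a b c d e f g h j : R} (hj : 2 * j = 1)
    (hX : a * d - b * c = 1) (hY : e * h - f * g = 1)
    (h₁ : a * e + b * g = -(e * a + f * c)) (h₂ : a * f + b * h = -(e * b + f * d))
    (h₃ : c * e + d * g = -(g * a + h * c)) (h₄ : c * f + d * h = -(g * b + h * d)) :
    d = -a ∧ h = -e ∧ 2 * a * e + b * g + c * f = 0 ∧
    (c * e - a * g) ^ 2 + g ^ 2 + c ^ 2 = 0 ∧
    c * (-j * a * e * f - b - b * f * g) + g * (-j * a * e * b - f) = 1 := by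
  -- Anticommutation makes `X` conjugate to `-X` and `Y` to `-Y`, so both traces vanish once 2 is
  -- invertible.
  have hd : d = -a := by
    linear_combination j * (h * h₁ - g * h₂ - f * h₃ + e * h₄) - (a + d) * (hj + 2 * j * hY)
  have hh : h = -e := by
    linear_combination j * (d * h₁ - c * h₂ - b * h₃ + a * h₄) - (e + h) * (hj + 2 * j * hX)
  subst hd hh
  have hE : 2 * a * e + b * g + c * f = 0 := by linear_combination h₁
  refine ⟨rfl, rfl, hE, ?_, ?_⟩
  -- Conceptually, `E₁₂ = -(c X + g Y + m X Y) / 2` with `m = c e - a g` the lower left entry of `X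
  -- Y`. As `X`, `Y`, `X Y` anticommute and square to `-1`, `E₁₂² = 0` gives the equation.
  · linear_combination -c * g * hE - g ^ 2 * hX - c ^ 2 * hY
  · linear_combination -j * a * e * hE + (1 + f * g) * hX - a ^ 2 * hY + a ^ 2 * e ^ 2 * hj

/-- The determinant `c e - a g` of the first columns `(e, g)` of `Y` and `(a, c)` of `X`, on
`S_{-I}`. -/
noncomputable def minor : Coord (-1 : SL(2, k)) :=
  (pair (-1) 0).1 1 0 * (pair (-1) 1).1 0 0 - (pair (-1) 0).1 0 0 * (pair (-1) 1).1 1 0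

/-- The linear form `c + u m + v g` on `S_{-I}`. -/
noncomputable def linForm (u v : k) : Coord (-1 : SL(2, k)) :=
  (pair (-1) 0).1 1 0 + algebraMap k _ u * minor + algebraMap k _ v * (pair (-1) 1).1 1 0

lemma negRight_chart (u v : k) :
    negRight (-1) ((pair (-1) 0).1 1 0 * linForm u v) = (pair (-1) 0).1 1 0 *
      ((pair (-1) 0).1 1 0 - algebraMap k _ u * minor - algebraMap k _ v * (pair (-1) 1).1 1 0) := by
  have h0 : ∀ i j, negRight (-1 : SL(2, k)) ((pair (-1) 0).1 i j) = (pair (-1) 0).1 i j :=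
    fun i j => lift_pair _ _ 0 i j
  have h1 : ∀ i j, negRight (-1 : SL(2, k)) ((pair (-1) 1).1 i j) = -(pair (-1) 1).1 i j :=
    fun i j => lift_pair _ _ 1 i j
  simp only [linForm, minor, map_mul, map_add, map_sub, h0, h1, AlgHom.commutes]
  ring

lemma swap_chart (u v : k) :
    swap ((pair (-1) 0).1 1 0 * linForm u v) = (pair (-1) 1).1 1 0 *
      ((pair (-1) 1).1 1 0 - algebraMap k _ u * minor + algebraMap k _ v * (pair (-1) 0).1 1 0) := by
  have h0 : ∀ i j, swap (k := k) ((pair (-1) 0).1 i j) = (pair (-1) 1).1 i j :=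
    fun i j => lift_pair _ _ 0 i j
  have h1 : ∀ i j, swap (k := k) ((pair (-1) 1).1 i j) = (pair (-1) 0).1 i j :=
    fun i j => lift_pair _ _ 1 i j
  simp only [linForm, minor, map_mul, map_add, map_sub, h0, h1, AlgHom.commutes]
  ring

lemma swap_negRight_chart (u v : k) :
    swap (negRight (-1) ((pair (-1) 0).1 1 0 * linForm u v)) = (pair (-1) 1).1 1 0 *
      ((pair (-1) 1).1 1 0 + algebraMap k _ u * minor - algebraMap k _ v * (pair (-1) 0).1 1 0) := by
  have h0 : ∀ i j, swap (k := k) ((pair (-1) 0).1 i j) = (pair (-1) 1).1 i j :=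
    fun i j => lift_pair _ _ 0 i j
  have h1 : ∀ i j, swap (k := k) ((pair (-1) 1).1 i j) = (pair (-1) 0).1 i j :=
    fun i j => lift_pair _ _ 1 i j
  rw [negRight_chart]
  simp only [minor, map_mul, map_sub, h0, h1, AlgHom.commutes]
  ring

/-- The generators add in pairs to `2 c²` and `2 g²`, while `c` and `g` generate the unit ideal. -/
lemma span_chart_eq_top {R : Type*} [CommRing R] {c g y z j A B : R} (hj : 2 * j = 1)
    (h1 : c * A + g * B = 1) :
    Ideal.span {c * (c + y), c * (c - y), g * (g - z), g * (g + z)} = ⊤ := by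
  set J : Ideal R := Ideal.span {c * (c + y), c * (c - y), g * (g - z), g * (g + z)} with hJ
  have m0 : c * (c + y) ∈ J := Ideal.subset_span (by simp)
  have m1 : c * (c - y) ∈ J := Ideal.subset_span (by simp)
  have m2 : g * (g - z) ∈ J := Ideal.subset_span (by simp)
  have m3 : g * (g + z) ∈ J := Ideal.subset_span (by simp)
  have hc : c ^ 2 ∈ J := by
    have e : c ^ 2 = j * (c * (c + y) + c * (c - y)) := by linear_combination -c ^ 2 * hj
    rw [e]
    exact J.mul_mem_left _ (J.add_mem m0 m1)
  have hg : g ^ 2 ∈ J := by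
    have e : g ^ 2 = j * (g * (g - z) + g * (g + z)) := by linear_combination -g ^ 2 * hj
    rw [e]
    exact J.mul_mem_left _ (J.add_mem m2 m3)
  have htop : Ideal.span {c, g} = (⊤ : Ideal R) := by
    rw [Ideal.eq_top_iff_one, Ideal.mem_span_pair]
    exact ⟨A, B, by linear_combination h1⟩
  refine top_unique ((Ideal.span_pow_eq_top _ htop 2).ge.trans (Ideal.span_le.2 ?_))
  rintro _ ⟨x, rfl | rfl, rfl⟩
  exacts [hc, hg]

set_option maxHeartbeats 1000000 in
/-- If `-1` is a sum of two squares, then the variety of anticommuting pairs is rational. -/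
theorem hasAffineChart_neg_one [CharZero k] {u v : k} (huv : -1 = u ^ 2 + v ^ 2) :
    HasAffineChart k (Coord (-1 : SL(2, k))) 3 := by
  have hUV : ∀ (R : Type u) [CommRing R] [Algebra k R],
      algebraMap k R u ^ 2 + algebraMap k R v ^ 2 = -1 := by
    intro R _ _
    rw [← map_pow, ← map_pow, ← map_add, ← huv, map_neg, map_one]
  have hX := det_entries (pair (-1 : SL(2, k)) 0)
  have hY := det_entries (pair (-1 : SL(2, k)) 1)
  obtain ⟨h₁, h₂, h₃, h₄⟩ := (commutator_eq_neg_one_iff _ _).1 (pair_comm (-1 : SL(2, k)))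
  obtain ⟨hd, hh, hE, hcone, h1⟩ := neg_one_relations
    (two_mul_algebraMap_inv_two k (Coord (-1 : SL(2, k)))) hX hY h₁ h₂ h₃ h₄
  clear h₁ h₂ h₃ h₄
  change minor ^ 2 + _ + _ = _ at hcone
  -- The form `linForm u v` is tangent to the conic at the `k`-point `(c : m : g) = (1 : u : v)`. In
  -- the coordinates `l = c + u m + v g` and `z = v m - u g` the conic is `z² = l (2 c - l)`,
  -- parametrized by `r = z / l`.
  have hq : (algebraMap k _ v * minor - algebraMap k _ u * (pair (-1 : SL(2, k)) 1).1 1 0) ^ 2 =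
      linForm u v * (2 * (pair (-1 : SL(2, k)) 0).1 1 0 - linForm u v) := by
    rw [linForm]
    linear_combination (minor ^ 2 + (pair (-1 : SL(2, k)) 1).1 1 0 ^ 2) *
      hUV (Coord (-1 : SL(2, k))) - hcone
  let G : MvPolynomial (Fin 3) k := .X 1 * (1 + .X 2 ^ 2)
  have hG0 : G ≠ 0 := by
    intro h
    have := congrArg (MvPolynomial.eval fun _ => (1 : k)) h
    norm_num [G] at this
  let f : Coord (-1 : SL(2, k)) := (pair (-1 : SL(2, k)) 0).1 1 0 * linForm u v
  let M := Localization.Away f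
  let L := Localization.Away G
  have : IsDomain L := isDomain_localizationAway hG0
  obtain ⟨i, hi⟩ := (IsLocalization.Away.algebraMap_isUnit (S := L) G).exists_right_inv
  obtain ⟨a, ha⟩ : ∃ y, y = algebraMap (MvPolynomial (Fin 3) k) L (.X 0) := ⟨_, rfl⟩
  obtain ⟨x, hx⟩ : ∃ y, y = algebraMap (MvPolynomial (Fin 3) k) L (.X 1) := ⟨_, rfl⟩
  obtain ⟨r, hr⟩ : ∃ y, y = algebraMap (MvPolynomial (Fin 3) k) L (.X 2) := ⟨_, rfl⟩
  have hi' : x * (1 + r ^ 2) * i = 1 := by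
    simpa only [G, map_mul, map_add, map_pow, map_one, ← hx, ← hr] using hi
  obtain ⟨j, hj⟩ : ∃ j : L, 2 * j = 1 := ⟨_, two_mul_algebraMap_inv_two k L⟩
  obtain ⟨U, hU⟩ : ∃ U, U = algebraMap k L u := ⟨_, rfl⟩
  obtain ⟨V, hV⟩ : ∃ V, V = algebraMap k L v := ⟨_, rfl⟩
  have hUVL := hUV L
  rw [← hU, ← hV] at hUVL
  -- From `l = x` and `z = x r` one gets `2 c - x = x r²`. Then `n = u m + v g = x - c`, and `u² +
  -- v² = -1` recovers `m` and `g`, here `μ` and `γ`, from `n` and `z`.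
  obtain ⟨c, hc⟩ : ∃ c, c = x * (1 + r ^ 2) * j := ⟨_, rfl⟩
  obtain ⟨n, hn⟩ : ∃ n, n = x * (1 - r ^ 2) * j := ⟨_, rfl⟩
  obtain ⟨μ, hμ⟩ : ∃ μ, μ = -(U * n + V * (x * r)) := ⟨_, rfl⟩
  obtain ⟨γ, hγ⟩ : ∃ γ, γ = -(V * n - U * (x * r)) := ⟨_, rfl⟩
  obtain ⟨c', hcc⟩ : ∃ c', c * c' = 1 :=
    ⟨2 * i, by linear_combination 2 * i * hc + 2 * j * hi' + hj⟩
  have hcone' : μ ^ 2 + γ ^ 2 + c ^ 2 = 0 := by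
    rw [hμ, hγ, hc, hn]
    linear_combination ((x * (1 - r ^ 2) * j) ^ 2 + (x * r) ^ 2) * hUVL +
      (x * r) ^ 2 * (2 * j + 1) * hj
  obtain ⟨e, he⟩ : ∃ e, e = (μ + a * γ) * c' := ⟨_, rfl⟩
  obtain ⟨b, hb⟩ : ∃ b, b = -(1 + a ^ 2) * c' := ⟨_, rfl⟩
  obtain ⟨F, hF⟩ : ∃ F, F = -(2 * a * e + b * γ) * c' := ⟨_, rfl⟩
  let φ : Coord (-1 : SL(2, k)) →ₐ[k] L := lift
    ![mkSL a b c (-a) (by rw [hb]; linear_combination (1 + a ^ 2) * hcc),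
      mkSL e F γ (-e) (by
        rw [hF, hb, he]
        linear_combination -c' ^ 2 * hcone' + (c * c' + 1) * hcc)] (by
    rw [commutator_eq_neg_one_iff]
    refine ⟨?_, ?_, ?_, ?_⟩
    · change a * e + b * γ = -(e * a + F * c)
      rw [hF]
      linear_combination -(2 * a * e + b * γ) * hcc
    · change a * F + b * -e = -(e * b + F * -a)
      ring
    · change c * e + -a * γ = -(γ * a + -e * c)
      ring
    · change c * F + -a * -e = -(γ * b + -e * -a)
      rw [hF]
      linear_combination -(2 * a * e + b * γ) * hcc)
  have hφ00 : φ ((pair (-1) 0).1 0 0) = a := lift_pair _ _ _ _ _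
  have hφ01 : φ ((pair (-1) 0).1 0 1) = b := lift_pair _ _ _ _ _
  have hφ10 : φ ((pair (-1) 0).1 1 0) = c := lift_pair _ _ _ _ _
  have hφ11 : φ ((pair (-1) 0).1 1 1) = -a := lift_pair _ _ _ _ _
  have hφ00' : φ ((pair (-1) 1).1 0 0) = e := lift_pair _ _ _ _ _
  have hφ01' : φ ((pair (-1) 1).1 0 1) = F := lift_pair _ _ _ _ _
  have hφ10' : φ ((pair (-1) 1).1 1 0) = γ := lift_pair _ _ _ _ _
  have hφ11' : φ ((pair (-1) 1).1 1 1) = -e := lift_pair _ _ _ _ _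
  have hφm : φ minor = μ := by
    rw [minor, map_sub, map_mul, map_mul, hφ00, hφ10, hφ00', hφ10', he]
    linear_combination (μ + a * γ) * hcc
  have hφl : φ (linForm u v) = x := by
    rw [linForm, map_add, map_add, map_mul, map_mul, hφ10, hφm, hφ10', AlgHom.commutes,
      AlgHom.commutes, ← hU, ← hV]
    linear_combination hc + U * hμ + V * hγ - n * hUVL + hn + x * hj
  have hφz : φ (algebraMap k _ v * minor - algebraMap k _ u * (pair (-1 : SL(2, k)) 1).1 1 0) =
      x * r := by
    rw [map_sub, map_mul, map_mul, hφm, hφ10', AlgHom.commutes, AlgHom.commutes, ← hU, ← hV]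
    linear_combination V * hμ - U * hγ - x * r * hUVL
  let m : Coord (-1 : SL(2, k)) →+* M := algebraMap (Coord (-1 : SL(2, k))) M
  obtain ⟨A, hA⟩ : ∃ A, A = m ((pair (-1) 0).1 0 0) := ⟨_, rfl⟩
  obtain ⟨B, hB⟩ : ∃ B, B = m ((pair (-1) 0).1 0 1) := ⟨_, rfl⟩
  obtain ⟨C, hC⟩ : ∃ C, C = m ((pair (-1) 0).1 1 0) := ⟨_, rfl⟩
  obtain ⟨D, hD⟩ : ∃ D, D = m ((pair (-1) 0).1 1 1) := ⟨_, rfl⟩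
  obtain ⟨A', hA'⟩ : ∃ A, A = m ((pair (-1) 1).1 0 0) := ⟨_, rfl⟩
  obtain ⟨B', hB'⟩ : ∃ B, B = m ((pair (-1) 1).1 0 1) := ⟨_, rfl⟩
  obtain ⟨C', hC'⟩ : ∃ C, C = m ((pair (-1) 1).1 1 0) := ⟨_, rfl⟩
  obtain ⟨D', hD'⟩ : ∃ D, D = m ((pair (-1) 1).1 1 1) := ⟨_, rfl⟩
  obtain ⟨N, hN⟩ : ∃ N, N = m minor := ⟨_, rfl⟩
  obtain ⟨l, hl⟩ : ∃ l, l = m (linForm u v) := ⟨_, rfl⟩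
  obtain ⟨z, hz⟩ : ∃ z, z = m (algebraMap k _ v * minor -
    algebraMap k _ u * (pair (-1 : SL(2, k)) 1).1 1 0) := ⟨_, rfl⟩
  obtain ⟨S, hS⟩ : ∃ U, U = algebraMap k M u := ⟨_, rfl⟩
  obtain ⟨T, hT⟩ : ∃ V, V = algebraMap k M v := ⟨_, rfl⟩
  have hSm : m (algebraMap k _ u) = S := by
    rw [hS]
    exact (IsScalarTower.algebraMap_apply k _ M u).symm
  have hTm : m (algebraMap k _ v) = T := by
    rw [hT]
    exact (IsScalarTower.algebraMap_apply k _ M v).symm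
  have hST := hUV M
  rw [← hS, ← hT] at hST
  have mX := congrArg m hX
  have mE := congrArg m hE
  have md := congrArg m hd
  have mh := congrArg m hh
  have mq := congrArg m hq
  simp only [map_mul, map_pow, ← hz] at mq
  simp only [map_mul, map_sub, map_add, map_neg, map_one, map_ofNat, map_zero,
    ← hA, ← hB, ← hC, ← hD, ← hA', ← hB', ← hC', ← hD', ← hl] at mX mE md mh mq
  have mN : N = C * A' - A * C' := by
    rw [hN, minor, map_sub, map_mul, map_mul, hA, hA', hC, hC']
  have ml : l = C + S * N + T * C' := by
    rw [hl, linForm, map_add, map_add, map_mul, map_mul, hSm, hTm, hC, hN, hC']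
  have mz : z = T * N - S * C' := by
    rw [hz, map_sub, map_mul, map_mul, hSm, hTm, hN, hC']
  have hmf : IsUnit (m f) := IsLocalization.Away.algebraMap_isUnit f
  obtain ⟨w, hw⟩ := hmf.exists_right_inv
  simp only [f, map_mul, ← hC, ← hl] at hw
  obtain ⟨l', hl'⟩ : ∃ l', l * l' = 1 := ⟨C * w, by linear_combination hw⟩
  obtain ⟨s, hs⟩ : ∃ s : M, 2 * s = 1 := ⟨_, two_mul_algebraMap_inv_two k M⟩
  have hK : l * (1 + (z * l') ^ 2) = 2 * C := by
    linear_combination l * l' ^ 2 * mq + (2 * C - l) * (l * l' + 1) * hl'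
  let ψ : MvPolynomial (Fin 3) k →ₐ[k] M := MvPolynomial.aeval ![A, l, z * l']
  have hψ0 : ψ (.X 0) = A := MvPolynomial.aeval_X _ _
  have hψ1 : ψ (.X 1) = l := MvPolynomial.aeval_X _ _
  have hψ2 : ψ (.X 2) = z * l' := MvPolynomial.aeval_X _ _
  refine HasAffineChart.of_translates (f := f) hG0 (nonempty_chart f G φ ψ ?_ ?_ ?_ ?_) φ
    (s := {f, negRight (-1) f, swap f, swap (negRight (-1) f)}) (by simp) ?_ ?_ ?_
  · simp only [f, map_mul, hφ10, hφl]
    exact (IsUnit.of_mul_eq_one c' hcc).mul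
      (IsUnit.of_mul_eq_one ((1 + r ^ 2) * i) (by linear_combination hi'))
  · simp only [G, map_mul, map_add, map_pow, map_one, hψ1, hψ2]
    rw [hK]
    exact (IsUnit.of_mul_eq_one s hs).mul (IsUnit.of_mul_eq_one (l * w) (by linear_combination hw))
  · intro χ hχ
    have hχa : χ a = A := by rw [ha, hχ, hψ0]
    have hχx : χ x = l := by rw [hx, hχ, hψ1]
    have hχr : χ r = z * l' := by rw [hr, hχ, hψ2]
    have hχU : χ U = S := by rw [hU, AlgHom.commutes, hS]
    have hχV : χ V = T := by rw [hV, AlgHom.commutes, hT]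
    have hχj : 2 * χ j = 1 := by
      have := congrArg χ hj
      rwa [map_mul, map_ofNat, map_one] at this
    have hχc : χ c = C := by
      simp only [hc, map_mul, map_add, map_one, map_pow, hχx, hχr]
      linear_combination χ j * hK + C * hχj
    have hχn : χ n = l - C := by
      simp only [hn, map_mul, map_sub, map_one, map_pow, hχx, hχr]
      linear_combination -χ j * hK + (l - C) * hχj
    have hχγ : χ γ = C' := by
      simp only [hγ, map_neg, map_mul, map_sub, hχx, hχr, hχn, hχU, hχV]
      linear_combination S * z * hl' + S * mz - T * ml - C' * hST
    have hχμ : χ μ = N := by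
      simp only [hμ, map_neg, map_mul, map_add, hχx, hχr, hχn, hχU, hχV]
      linear_combination -T * z * hl' - T * mz - S * ml - N * hST
    have hχcc : C * χ c' = 1 := by
      have := congrArg χ hcc
      rwa [map_mul, map_one, hχc] at this
    have hχe : χ e = A' := by
      simp only [he, map_mul, map_add, hχμ, hχa, hχγ]
      linear_combination χ c' * mN + A' * hχcc
    have hχb : χ b = B := by
      simp only [hb, map_mul, map_neg, map_add, map_one, map_pow, hχa]
      linear_combination χ c' * mX - χ c' * A * md + B * hχcc
    have hχF : χ F = B' := by
      simp only [hF, map_mul, map_neg, map_add, map_ofNat, hχa, hχe, hχb, hχγ]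
      linear_combination -χ c' * mE + B' * hχcc
    apply algHom_ext_entries
    · change χ (φ _) = m _
      rw [hφ00, hχa, hA]
    · change χ (φ _) = m _
      rw [hφ01, hχb, hB]
    · change χ (φ _) = m _
      rw [hφ10, hχc, hC]
    · change χ (φ _) = m _
      rw [hφ11, map_neg, hχa, ← hD, md]
    · change χ (φ _) = m _
      rw [hφ00', hχe, hA']
    · change χ (φ _) = m _
      rw [hφ01', hχF, hB']
    · change χ (φ _) = m _
      rw [hφ10', hχγ, hC']
    · change χ (φ _) = m _
      rw [hφ11', map_neg, hχe, ← hD', mh]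
  · intro χ hχ t
    have hχ' : ∀ a, χ (m a) = φ a := hχ
    have hχl := congrArg χ hl'
    rw [map_mul, map_one, hl, hχ', hφl] at hχl
    fin_cases t
    · change χ (ψ (.X 0)) = algebraMap (MvPolynomial (Fin 3) k) L (.X 0)
      rw [hψ0, hA, hχ', hφ00, ha]
    · change χ (ψ (.X 1)) = algebraMap (MvPolynomial (Fin 3) k) L (.X 1)
      rw [hψ1, hl, hχ', hφl, hx]
    · change χ (ψ (.X 2)) = algebraMap (MvPolynomial (Fin 3) k) L (.X 2)
      rw [hψ2, map_mul, hz, hχ', hφz, ← hr]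
      linear_combination r * hχl
  · simp only [f]
    rw [swap_negRight_chart, negRight_chart, swap_chart, linForm]
    convert span_chart_eq_top (y := algebraMap k _ u * minor +
      algebraMap k _ v * (pair (-1) 1).1 1 0) (z := algebraMap k _ u * minor -
      algebraMap k _ v * (pair (-1) 0).1 1 0)
      (two_mul_algebraMap_inv_two k (Coord (-1 : SL(2, k)))) h1 using 4 <;> ring_nf
  · rintro a (rfl | rfl | rfl | rfl)
    · exact ⟨AlgHom.id k _, AlgHom.id k _, rfl, rfl⟩
    · exact ⟨negRight (-1), negRight (-1), negRight_comp (-1), rfl⟩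
    · exact ⟨swap, swap, swap_comp, rfl⟩
    · refine ⟨swap.comp (negRight (-1)), (negRight (-1)).comp swap, ?_, rfl⟩
      refine AlgHom.ext fun y => ?_
      change swap (negRight (-1) (negRight (-1) (swap y))) = y
      rw [show negRight (-1) (negRight (-1) (swap y)) = swap y from
        DFunLike.congr_fun (negRight_comp (-1 : SL(2, k))) _]
      exact DFunLike.congr_fun swap_comp y
  · have hx0 : x ≠ 0 := left_ne_zero_of_mul_eq_one
      (show x * ((1 + r ^ 2) * i) = 1 by linear_combination hi')
    have hc0 : c ≠ 0 := left_ne_zero_of_mul_eq_one hcc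
    have huv0 : ¬(u = 0 ∧ v = 0) := by
      rintro ⟨rfl, rfl⟩
      norm_num at huv
    -- A quadratic polynomial in `r` is nonzero as soon as its value at `0` or at `1` is.
    have hne : ∀ α β δ : k, (β ≠ 0 ∨ α + β + δ ≠ 0) →
        algebraMap k L α * r ^ 2 + algebraMap k L δ * r + algebraMap k L β ≠ 0 := by
      intro α β δ h
      have : algebraMap (MvPolynomial (Fin 3) k) L (.C α * .X 2 ^ 2 + .C δ * .X 2 + .C β) =
          algebraMap k L α * r ^ 2 + algebraMap k L δ * r + algebraMap k L β := by
        rw [map_add, map_add, map_mul, map_mul, map_pow, ← hr]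
        rfl
      rw [← this]
      rcases h with h | h
      · exact algebraMap_ne_zero_of_eval hG0 0 (by simpa using h)
      · refine algebraMap_ne_zero_of_eval hG0 1 ?_
        simp only [map_add, map_mul, map_pow, MvPolynomial.eval_C, MvPolynomial.eval_X,
          Pi.one_apply, one_pow, mul_one]
        intro h'
        exact h (by linear_combination h')
    have hγ0 : γ ≠ 0 := by
      intro h0
      have := hne v (-v) (2 * u) (by
        by_cases hv : v = 0
        · right
          simpa [hv] using huv0
        · left
          simpa using hv)
      rw [map_neg, map_mul, map_ofNat, ← hU, ← hV] at this
      refine mul_ne_zero hx0 this ?_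
      linear_combination 2 * h0 - 2 * hγ + 2 * V * hn + V * x * (1 - r ^ 2) * hj
    rintro a (rfl | rfl | rfl | rfl)
    · simp only [f, map_mul, hφ10, hφl]
      exact mul_ne_zero hc0 hx0
    · rw [negRight_chart]
      simp only [map_mul, map_sub, hφ10, hφm, hφ10', AlgHom.commutes, ← hU, ← hV]
      refine mul_ne_zero hc0 fun h0 => ?_
      have := hne 1 0 0 (by simp)
      simp only [map_one, map_zero, one_mul, zero_mul, add_zero] at this
      refine mul_ne_zero hx0 this ?_
      linear_combination h0 - hc + U * hμ + V * hγ - n * hUVL + hn - x * r ^ 2 * hj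
    · rw [swap_chart]
      simp only [map_mul, map_sub, map_add, hφ10, hφm, hφ10', AlgHom.commutes, ← hU, ← hV]
      -- This linear form too is tangent to the conic at a `k`-point, so in the parameter `r` it is
      -- a square: `x ((1 + v) r + u)² / 2`. For the last translate the square is `(u r + 1 - v)²`.
      refine mul_ne_zero hγ0 fun h0 => ?_
      have := hne 0 u (1 + v) (by
        by_cases hu : u = 0
        · right
          subst hu
          intro hv
          apply two_ne_zero (α := k)
          linear_combination -huv + (1 - v) * hv
        · exact .inl hu)
      rw [map_zero, zero_mul, zero_add, map_add, map_one, ← hU, ← hV] at this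
      refine mul_ne_zero hx0 (pow_ne_zero 2 this) ?_
      linear_combination 2 * h0 - 2 * hγ + 2 * U * hμ - 2 * V * hc - 2 * (U ^ 2 - V) * hn -
        x * ((U ^ 2 - V) * (1 - r ^ 2) + V * (1 + r ^ 2)) * hj + x * r ^ 2 * hUVL
    · rw [swap_negRight_chart]
      simp only [map_mul, map_sub, map_add, hφ10, hφm, hφ10', AlgHom.commutes, ← hU, ← hV]
      refine mul_ne_zero hγ0 fun h0 => ?_
      have := hne 0 (1 - v) u (by
        by_cases hv : 1 - v = 0
        · right
          intro h'
          apply two_ne_zero (α := k)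
          linear_combination -huv + (1 + v) * hv - u * (h' - hv)
        · exact .inl hv)
      rw [map_zero, zero_mul, zero_add, map_sub, map_one, ← hU, ← hV] at this
      refine mul_ne_zero hx0 (pow_ne_zero 2 this) ?_
      linear_combination 2 * h0 - 2 * hγ - 2 * U * hμ + 2 * V * hc + 2 * (U ^ 2 + V) * hn +
        x * ((U ^ 2 + V) * (1 - r ^ 2) + V * (1 + r ^ 2)) * hj + x * hUVL

end NegOne

/-! ### Rational points, reduction to Jordan form, and conclusion -/

section Main

variable {k : Type u} [Field k]

/-- A rational point of the commutator variety is a morphism from its coordinate ring to `k`. -/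
lemma nonempty_algHom_of_ratPoint {α : SL(2, k)} (p : RatPoint (structureMap α)) :
    Nonempty (Coord α →ₐ[k] k) := by
  obtain ⟨p, hp⟩ := p
  let q : CommRingCat.of (CoordRing α) ⟶ CommRingCat.of k := Spec.preimage p
  have hq : CommRingCat.ofHom (algebraMap k (CoordRing α)) ≫ q = 𝟙 _ := by
    apply Spec.map_injective
    rw [Spec.map_comp, Spec.map_id, show Spec.map q = p from Spec.map_preimage p]
    exact hp
  let φ : CoordRing α →ₐ[k] k :=
    { __ := q.hom
      commutes' := fun x => congrArg (fun g => g.hom x) hq }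
  exact ⟨φ.comp (coordEquiv α).toAlgHom⟩

/-- If `S_{-I}` has a rational point, then `-1` is a sum of two squares. -/
lemma exists_sum_sq_of_ratPoint [CharZero k]
    (p : RatPoint (structureMap (-1 : SL(2, k)))) : ∃ a b : k, -1 = a ^ 2 + b ^ 2 := by
  obtain ⟨φ⟩ := nonempty_algHom_of_ratPoint p
  have hφ := map_pair_comm φ
  set X := SpecialLinearGroup.map (φ : Coord (-1 : SL(2, k)) →+* k) (pair (-1) 0)
  set Y := SpecialLinearGroup.map (φ : Coord (-1 : SL(2, k)) →+* k) (pair (-1) 1)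
  obtain ⟨h₁, h₂, h₃, h₄⟩ := (commutator_eq_neg_one_iff X Y).1 hφ
  obtain ⟨hd, -, -, hcone, -⟩ := neg_one_relations (mul_inv_cancel₀ two_ne_zero) (det_entries X)
    (det_entries Y) h₁ h₂ h₃ h₄
  -- If `c = 0`, the trace-zero matrix `X` of determinant 1 gives `-1 = a²`. Otherwise the conic
  -- equation is divided by `c²`.
  by_cases hc : X.1 1 0 = 0
  · have hX := det_entries X
    rw [hc, hd] at hX
    exact ⟨X.1 0 0, 0, by linear_combination hX⟩
  · refine ⟨(X.1 1 0 * Y.1 0 0 - X.1 0 0 * Y.1 1 0) / X.1 1 0, Y.1 1 0 / X.1 1 0, ?_⟩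
    field_simp
    linear_combination -hcone

/-- A non-scalar element of `SL(2)` with a double eigenvalue `ε = ±1` is conjugate to a Jordan
block. -/
lemma exists_conjSL_jordan {α : SL(2, k)} {ε : k} (hε : ε * ε = 1)
    (hα : α ∉ Subgroup.center SL(2, k)) (ht : α.1.trace = 2 * ε) :
    ∃ P : GL (Fin 2) k, conjSL P (jordan ε hε) = α := by
  have hdet := det_entries α
  rw [trace_fin_two] at ht
  suffices h : ∃ P : Matrix (Fin 2) (Fin 2) k, P.det ≠ 0 ∧ P * (jordan ε hε).1 = α.1 * P by
    obtain ⟨P, hP, hPα⟩ := h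
    refine ⟨GeneralLinearGroup.mkOfDetNeZero P hP, Subtype.ext ?_⟩
    change P * (jordan ε hε).1 * (GeneralLinearGroup.mkOfDetNeZero P hP)⁻¹.1 = α.1
    rw [hPα, mul_assoc]
    exact (congrArg (α.1 * ·) (GeneralLinearGroup.mkOfDetNeZero P hP).mul_inv).trans (mul_one _)
  have hJ : (jordan ε hε).1 = !![ε, ε; 0, ε] := rfl
  by_cases hl : α.1 1 0 = 0
  · have hn : α.1 0 0 = ε := by
      have : (α.1 0 0 - ε) ^ 2 = 0 := by
        linear_combination α.1 0 0 * ht - hdet - α.1 0 1 * hl + hε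
      exact sub_eq_zero.1 (pow_eq_zero_iff two_ne_zero |>.1 this)
    have hn' : α.1 1 1 = ε := by linear_combination ht - hn
    have hm : α.1 0 1 ≠ 0 := by
      intro hm
      refine hα (Subgroup.mem_center_iff.2 fun β => Subtype.ext ?_)
      have : α.1 = ε • (1 : Matrix (Fin 2) (Fin 2) k) := by
        ext i j
        fin_cases i <;> fin_cases j <;> simp [hl, hm, hn, hn']
      change β.1 * α.1 = α.1 * β.1
      rw [this]
      simp
    -- In both cases the second column of `P` is `ε` times a basis vector not fixed up to the scalar
    -- `ε`, and the first column is `α - ε` applied to that basis vector.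
    refine ⟨!![α.1 0 1, 0; 0, ε], ?_, ?_⟩
    · have : ε ≠ 0 := left_ne_zero_of_mul_eq_one hε
      simp [det_fin_two, hm, this]
    · rw [hJ]
      ext i j
      fin_cases i <;> fin_cases j <;> simp [mul_apply, hl, hn, hn', mul_comm]
  · refine ⟨!![α.1 0 0 - ε, ε; α.1 1 0, 0], ?_, ?_⟩
    · have : ε ≠ 0 := left_ne_zero_of_mul_eq_one hε
      simp [det_fin_two, hl, this]
    · rw [hJ]
      ext i j
      fin_cases i <;> fin_cases j <;> simp [mul_apply]
      · linear_combination -α.1 0 0 * ht + hdet - hε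
      · ring
      · linear_combination -α.1 1 0 * ht

theorem isRationalOfDim_neg_one [CharZero k] {u v : k} (huv : -1 = u ^ 2 + v ^ 2) :
    IsRationalOfDim (structureMap (-1 : SL(2, k))) 3 :=
  ((hasAffineChart_neg_one huv).of_algEquiv (coordEquiv _)).isRationalOfDim

theorem isEmpty_ratPoint_neg_one [CharZero k] (h : ¬ ∃ a b : k, -1 = a ^ 2 + b ^ 2) :
    IsEmpty (RatPoint (structureMap (-1 : SL(2, k)))) :=
  ⟨fun p => h (exists_sum_sq_of_ratPoint p)⟩

theorem not_isRationalOver_neg_one [CharZero k] (h : ¬ ∃ a b : k, -1 = a ^ 2 + b ^ 2) :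
    ¬ Scheme.IsRationalOver (structureMap (-1 : SL(2, k))) := fun hr => by
  have : Infinite k := CharZero.infinite k
  exact not_isEmpty_iff.2 (exists_section_of_isRationalOver _ hr) (isEmpty_ratPoint_neg_one h)

theorem isRationalOfDim_of_trace [CharZero k] {α : SL(2, k)} (hα : α ∉ Subgroup.center SL(2, k))
    (ht : α.1.trace = 2 ∨ α.1.trace = -2) : IsRationalOfDim (structureMap α) 3 := by
  rcases ht with ht | ht
  · obtain ⟨P, hP⟩ := exists_conjSL_jordan (mul_one 1) hα (by rw [ht, mul_one])
    exact ((hasAffineChart_unipotent.of_algEquiv (conjEquiv P hP).symm).of_algEquiv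
      (coordEquiv α)).isRationalOfDim
  · have hε : (-1 : k) * -1 = 1 := by norm_num
    obtain ⟨P, hP⟩ := exists_conjSL_jordan hε hα (by rw [ht]; norm_num)
    exact (((hasAffineChart_jordan_neg_one hε).of_algEquiv (conjEquiv P hP).symm).of_algEquiv
      (coordEquiv α)).isRationalOfDim

end Main

end CommutatorVariety

theorem mainTheorem5 {k : Type*} [Field k] [CharZero k] :
    ((∃ a b : k, -1 = a ^ 2 + b ^ 2) →
      CommutatorVariety.IsRationalOfDim
        (CommutatorVariety.structureMap (-1 : Matrix.SpecialLinearGroup (Fin 2) k)) 3) ∧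
    ((¬ ∃ a b : k, -1 = a ^ 2 + b ^ 2) →
      IsEmpty (CommutatorVariety.RatPoint
        (CommutatorVariety.structureMap (-1 : Matrix.SpecialLinearGroup (Fin 2) k))) ∧
      ¬ AlgebraicGeometry.Scheme.IsRationalOver
        (CommutatorVariety.structureMap (-1 : Matrix.SpecialLinearGroup (Fin 2) k))) ∧
    (∀ α : Matrix.SpecialLinearGroup (Fin 2) k,
      α ∉ Subgroup.center (Matrix.SpecialLinearGroup (Fin 2) k) →
      (α : Matrix (Fin 2) (Fin 2) k).trace = 2 ∨ (α : Matrix (Fin 2) (Fin 2) k).trace = -2 →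
      CommutatorVariety.IsRationalOfDim (CommutatorVariety.structureMap α) 3) := by
  exact ⟨fun ⟨_, _, h⟩ => CommutatorVariety.isRationalOfDim_neg_one h,
    fun h => ⟨CommutatorVariety.isEmpty_ratPoint_neg_one h,
      CommutatorVariety.not_isRationalOver_neg_one h⟩,
    fun _ hα ht => CommutatorVariety.isRationalOfDim_of_trace hα ht⟩
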